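/- **Setting.** Manifolds and diffeomorphisms are $C^\infty$. *Braids and links.* For integers $p\ge 1$, $q\ge 2$ let $B_{p,q}=\sigma_{q-1}\sigma_{q-2}\cdots\sigma_2\,\sigma_1^{2p-1}$, a braid on $q$ strands, let $\hat B_{p,q}\subset S^3$ be its closure (an oriented knot), let $A\subset S^3$ be the unknotted axis of the closed braid, and let $L_{p,q}=A\cup \hat B_{p,q}$. For a component $K$ of a link, $\mu(K)$ and $\lambda(K)$ denote its meridian and its (null-homologous in $S^3\setminus K$) longitude on $\partial\nu K$; $\nu$ denotes tubular neighbourhoods, and those of the two components of $L_{p,q}$ are chosen disjoint. *Elliptic surfaces.* $E(1)$ is the blow-up of $\mathbb{CP}^2$ at the nine base points of a pencil of cubics spanned by two cubics that intersect transversely, with its elliptic fibration $E(1)\to\mathbb{CP}^1$. A regular fiber $F\cong T^2$ has a tubular neighbourhood $\nu F\cong F\times D^2$ trivialized by the fibration. For $n\ge 2$, $E(n)=E(1)\#_{F'=F}E(n-1)$ is the fiber sum along a regular fiber $F'$ of $E(1)$ whose neighbourhood is disjoint from that of $F$; the regular fiber $F$ of this first copy of $E(1)$ serves as the fiber $F\subset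 E(n)$. *Fiber sum.* If $T\subset X$ and $F\subset Y$ are framed tori of self-intersection zero in 4-manifolds, with parametrizations by $T^2$, then $$X\#_{T=F}Y=[X\setminus\nu T]\cup_{T\times\partial D^2=F\times\partial D^2}[Y\setminus \nu F],$$ where the gluing map identifies $T$ with $F$ and is complex conjugation on $\partial D^2$. *Link surgery manifolds.* Let $L=K_1\cup\dots\cup K_m\subset S^3$ be a link and, for each $i$, let $(\alpha_i,\beta_i)$ be a homology basis of simple closed curves on $\partial\nu K_i$ with intersection number $1$. Then $$E(n_1,\dots,n_m)_L=\Big[\coprod_{i=1}^m E(n_i)\setminus\nu F_i\Big]\bigcup_{F_i\times\partial D^2=(S^1\times\alpha_i)\times\beta_i}\big[S^1\times(S^3\setminus\nu L)\big],$$ where the gluing maps identify the fiber $F_i$ with $S^1\times\alpha_i$ and act as complex conjugation on the remaining circle factor ($\partial D^2\to\beta_i$). *The tori.* The exterior of the unknot $A$ is a solid torus; identify $\nu F\subset E(n)$ with $S^1\times(S^3\setminus\nu A)$ so that $F$ corresponds to $S^1\times\mu(A)$ and $\partial D^2$ to $\lambda(A)$ by complex conjugation. Then $T_{p,q}=S^1\times\hat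 B_{p,q}\subset S^1\times(S^3\setminus\nu A)\cong\nu F\subset E(n)$ is an embedded torus of self-intersection zero. It is parametrized by $S^1\times\hat B_{p,q}$ and framed by the longitude $\lambda(\hat B_{p,q})$. **Lemma.** Let $n,r,p\ge 1$ and $q\ge 2$ be integers. Then the fiber sum $E(n)\#_{T_{p,q}=F}E(r)$ is diffeomorphic to the link surgery manifold $E(n,r)_{L_{p,q}}$ that is formed with the homology bases $$(\alpha_1,\beta_1)=(\mu(A),\lambda(A)),\qquad (\alpha_2,\beta_2)=(\lambda(\hat B_{p,q}),-\mu(\hat B_{p,q})).$$ -/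

import Mathlib

open Set Topology Manifold Metric
open scoped ContDiff

noncomputable section

namespace LinkSurgery

/-! ### Smooth 4-manifolds and gluing -/

/-- The model space of all 4-manifolds below: `ℝ¹ × ℝ³`, the model space of `S¹ × S³`. -/
abbrev H4 : Type := ModelProd (EuclideanSpace ℝ (Fin 1)) (EuclideanSpace ℝ (Fin 3))

/-- The (boundaryless) model with corners on `ℝ¹ × ℝ³`. -/
abbrev I4 : ModelWithCorners ℝ (EuclideanSpace ℝ (Fin 1) × EuclideanSpace ℝ (Fin 3)) H4 :=
  (𝓡 1).prod (𝓡 3)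

/-- A Hausdorff smooth 4-manifold without boundary. -/
structure Mfd4 where
  carrier : Type
  [top : TopologicalSpace carrier]
  [charts : ChartedSpace H4 carrier]
  [smooth : IsManifold I4 ∞ carrier]
  [hausdorff : T2Space carrier]

instance : CoeSort Mfd4 Type := ⟨Mfd4.carrier⟩

attribute [instance] Mfd4.top Mfd4.charts Mfd4.smooth Mfd4.hausdorff

section PartialDiffeo

variable {E₁ H₁ M₁ E₂ H₂ M₂ E₃ H₃ M₃ : Type*}
  [NormedAddCommGroup E₁] [NormedSpace ℝ E₁] [TopologicalSpace H₁] [TopologicalSpace M₁]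
  [ChartedSpace H₁ M₁]
  [NormedAddCommGroup E₂] [NormedSpace ℝ E₂] [TopologicalSpace H₂] [TopologicalSpace M₂]
  [ChartedSpace H₂ M₂]
  [NormedAddCommGroup E₃] [NormedSpace ℝ E₃] [TopologicalSpace H₃] [TopologicalSpace M₃]
  [ChartedSpace H₃ M₃]

/-- A homeomorphism between open subsets of manifolds is a diffeomorphism between them. -/
def IsDiffeo (I₁ : ModelWithCorners ℝ E₁ H₁) (I₂ : ModelWithCorners ℝ E₂ H₂)
    (e : OpenPartialHomeomorph M₁ M₂) : Prop :=
  ContMDiffOn I₁ I₂ ∞ e e.source ∧ ContMDiffOn I₂ I₁ ∞ e.symm e.target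

variable {I₁ : ModelWithCorners ℝ E₁ H₁} {I₂ : ModelWithCorners ℝ E₂ H₂}
  {I₃ : ModelWithCorners ℝ E₃ H₃}

theorem IsDiffeo.symm {e : OpenPartialHomeomorph M₁ M₂} (he : IsDiffeo I₁ I₂ e) :
    IsDiffeo I₂ I₁ e.symm := ⟨he.2, he.1⟩

theorem IsDiffeo.trans {e : OpenPartialHomeomorph M₁ M₂} {f : OpenPartialHomeomorph M₂ M₃}
    (he : IsDiffeo I₁ I₂ e) (hf : IsDiffeo I₂ I₃ f) : IsDiffeo I₁ I₃ (e.trans f) := by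
  constructor
  · exact hf.1.comp (he.1.mono (by simp)) (by intro x hx; simp at hx; exact hx.2)
  · refine he.2.comp (hf.2.mono ?_) ?_
    · intro x hx
      simp at hx
      exact hx.1
    · intro x hx
      simp at hx
      exact hx.2

theorem IsDiffeo.restr {e : OpenPartialHomeomorph M₁ M₂} (he : IsDiffeo I₁ I₂ e) {s : Set M₁} (hs : IsOpen s) :
    IsDiffeo I₁ I₂ (e.restrOpen s hs) := by
  refine ⟨he.1.mono (by intro x hx; exact hx.1), he.2.mono ?_⟩
  intro x hx
  simp at hx
  exact hx.1

theorem isDiffeo_refl : IsDiffeo I₁ I₁ (OpenPartialHomeomorph.refl M₁) :=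
  ⟨contMDiffOn_id, contMDiffOn_id⟩

end PartialDiffeo

/-- Data for gluing manifolds `piece (some i)`, `i : ι`, to a manifold `piece none`, each of them
restricted to an open subset `dom j`, along diffeomorphisms `glue i` between open subsets. -/
structure Gluing (ι : Type) where
  piece : Option ι → Mfd4
  dom : ∀ j, Set (piece j)
  isOpen_dom : ∀ j, IsOpen (dom j)
  glue : ∀ i, OpenPartialHomeomorph (piece (some i)) (piece none)
  source_subset : ∀ i, (glue i).source ⊆ dom (some i)
  target_subset : ∀ i, (glue i).target ⊆ dom none
  isDiffeo_glue : ∀ i, IsDiffeo I4 I4 (glue i)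
  disjoint_target : ∀ i k, i ≠ k → Disjoint (glue i).target (glue k).target
  separated : ∀ i, ∀ x ∈ dom (some i), x ∉ (glue i).source → ∀ c ∈ dom none,
    c ∉ (glue i).target → ∃ U V, IsOpen U ∧ IsOpen V ∧ x ∈ U ∧ c ∈ V ∧
      ∀ x' ∈ U ∩ (glue i).source, glue i x' ∉ V

namespace Gluing

variable {ι : Type} (G : Gluing ι)

open Classical in
/-- Normal form of a point of the disjoint union of the pieces: a point in the domain of a gluing
map is replaced by its image. -/
def normal : (Σ j, G.dom j) → Σ j, G.dom j
  | ⟨none, c⟩ => ⟨none, c⟩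
  | ⟨some i, x⟩ =>
    if h : x.1 ∈ (G.glue i).source then
      ⟨none, ⟨G.glue i x.1, G.target_subset i ((G.glue i).map_source h)⟩⟩
    else ⟨some i, x⟩

/-- Two points of the disjoint union are identified when they have the same normal form. -/
def setoid : Setoid (Σ j, G.dom j) := Setoid.ker G.normal

/-- The glued space, with the quotient topology. -/
def Space : Type := Quotient G.setoid

instance : TopologicalSpace G.Space := inferInstanceAs (TopologicalSpace (Quotient G.setoid))

def proj : (Σ j, G.dom j) → G.Space := Quotient.mk G.setoid

theorem proj_eq {a b : Σ j, G.dom j} : G.proj a = G.proj b ↔ G.normal a = G.normal b :=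
  Quotient.eq (r := G.setoid)

theorem continuous_proj : Continuous G.proj := continuous_quotient_mk'

theorem surjective_proj : Function.Surjective G.proj := Quotient.mk_surjective

theorem proj_none_none {c d : G.dom none} : G.proj ⟨none, c⟩ = G.proj ⟨none, d⟩ ↔ c = d := by
  rw [proj_eq]; simp [normal]

theorem proj_some_none {i : ι} {x : G.dom (some i)} {c : G.dom none} :
    G.proj ⟨some i, x⟩ = G.proj ⟨none, c⟩ ↔ x.1 ∈ (G.glue i).source ∧ G.glue i x.1 = c.1 := by
  rw [proj_eq]
  by_cases h : x.1 ∈ (G.glue i).source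
  · simp [normal, h, Subtype.ext_iff]
  · simp [normal, h]

theorem proj_some_self {i : ι} {x y : G.dom (some i)} :
    G.proj ⟨some i, x⟩ = G.proj ⟨some i, y⟩ ↔ x = y := by
  rw [proj_eq]
  by_cases h : x.1 ∈ (G.glue i).source <;> by_cases h' : y.1 ∈ (G.glue i).source
  · simp only [normal, h, h', dite_true, Sigma.mk.injEq, heq_eq_eq, true_and, Subtype.mk.injEq]
    rw [(G.glue i).injOn.eq_iff h h', Subtype.ext_iff]
  · simp only [normal, h, h', dite_true, dite_false]
    constructor
    · intro hh; simp at hh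
    · rintro rfl; exact absurd h h'
  · simp only [normal, h, h', dite_true, dite_false]
    constructor
    · intro hh; simp at hh
    · rintro rfl; exact absurd h' h
  · simp [normal, h, h']

theorem proj_some_ne {i k : ι} (hik : i ≠ k) (x : G.dom (some i)) (y : G.dom (some k)) :
    G.proj ⟨some i, x⟩ ≠ G.proj ⟨some k, y⟩ := by
  rw [Ne, proj_eq]
  by_cases h : x.1 ∈ (G.glue i).source <;> by_cases h' : y.1 ∈ (G.glue k).source
  · simp only [normal, h, h', dite_true, Sigma.mk.injEq, heq_eq_eq, true_and, Subtype.mk.injEq]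
    intro hh
    exact Set.disjoint_left.1 (G.disjoint_target i k hik) ((G.glue i).map_source h)
      (hh ▸ (G.glue k).map_source h')
  · simp [normal, h, h']
  · simp [normal, h, h']
  · simp [normal, h, h', hik]

theorem proj_self {j : Option ι} {x y : G.dom j} :
    G.proj ⟨j, x⟩ = G.proj ⟨j, y⟩ ↔ x = y := by
  cases j with
  | none => exact G.proj_none_none
  | some i => exact G.proj_some_self

theorem isOpenMap_proj : IsOpenMap G.proj := by
  intro W hW
  rw [isOpen_sigma_iff] at hW
  have key : ∀ j k (A : Set (G.dom j)), IsOpen A →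
      IsOpen {y : G.dom k | ∃ x ∈ A, G.proj ⟨k, y⟩ = G.proj ⟨j, x⟩} := by
    intro j k A hA
    have hA' : IsOpen (Subtype.val '' A) := (G.isOpen_dom j).isOpenMap_subtype_val A hA
    rcases j with _ | i <;> rcases k with _ | k
    · simpa [proj_none_none] using hA
    · have : {y : G.dom (some k) | ∃ x ∈ A, G.proj ⟨some k, y⟩ = G.proj ⟨none, x⟩} =
          Subtype.val ⁻¹' ((G.glue k).source ∩ G.glue k ⁻¹' (Subtype.val '' A)) := by
        ext y
        simp only [proj_some_none, mem_ofPred_eq, mem_preimage, mem_inter_iff, mem_image]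
        constructor
        · rintro ⟨x, hx, h1, h2⟩
          exact ⟨h1, x, hx, h2.symm⟩
        · rintro ⟨h1, x, hx, h2⟩
          exact ⟨x, hx, h1, h2.symm⟩
      rw [this]
      exact ((G.glue k).isOpen_inter_preimage hA').preimage continuous_subtype_val
    · have : {y : G.dom none | ∃ x ∈ A, G.proj ⟨none, y⟩ = G.proj ⟨some i, x⟩} =
          Subtype.val ⁻¹' ((G.glue i) '' ((G.glue i).source ∩ (Subtype.val '' A))) := by
        ext y
        simp only [eq_comm (a := G.proj ⟨none, y⟩), proj_some_none, mem_ofPred_eq, mem_preimage,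
          mem_inter_iff, mem_image]
        constructor
        · rintro ⟨x, hx, h1, h2⟩
          exact ⟨x.1, ⟨h1, x, hx, rfl⟩, h2⟩
        · rintro ⟨_, ⟨h1, x, hx, rfl⟩, h2⟩
          exact ⟨x, hx, h1, h2⟩
      rw [this]
      exact ((G.glue i).isOpen_image_source_inter hA').preimage continuous_subtype_val
    · by_cases hik : i = k
      · subst hik
        simpa [proj_some_self] using hA
      · have : {y : G.dom (some k) | ∃ x ∈ A, G.proj ⟨some k, y⟩ = G.proj ⟨some i, x⟩} = ∅ := by
          ext y
          simp [G.proj_some_ne (Ne.symm hik)]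
        rw [this]
        exact isOpen_empty
  change IsOpen (Quotient.mk G.setoid '' W)
  rw [← isQuotientMap_quotient_mk'.isOpen_preimage, isOpen_sigma_iff]
  intro k
  have : Sigma.mk k ⁻¹' (Quotient.mk G.setoid ⁻¹' (Quotient.mk G.setoid '' W)) =
      ⋃ j, {y : G.dom k | ∃ x ∈ (Sigma.mk j ⁻¹' W), G.proj ⟨k, y⟩ = G.proj ⟨j, x⟩} := by
    ext y
    simp only [mem_preimage, mem_image, mem_iUnion, mem_ofPred_eq]
    constructor
    · rintro ⟨⟨j, x⟩, h1, h2⟩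
      exact ⟨j, x, h1, h2.symm⟩
    · rintro ⟨j, x, h1, h2⟩
      exact ⟨⟨j, x⟩, h1, h2.symm⟩
  have h2 := isOpen_iUnion fun j => key j k _ (hW j)
  rw [← this] at h2
  exact h2

theorem isOpenEmbedding (j : Option ι) :
    IsOpenEmbedding (fun x : G.dom j => G.proj ⟨j, x⟩) :=
  IsOpenEmbedding.of_continuous_injective_isOpenMap
    (G.continuous_proj.comp continuous_sigmaMk) (fun _ _ h => G.proj_self.1 h)
    (G.isOpenMap_proj.comp isOpenMap_sigmaMk)

/-- The inclusion of the piece `j` into the glued space, as a homeomorphism from the open subset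
`dom j` onto an open subset. -/
def incl (j : Option ι) [h : Nonempty (G.dom j)] : OpenPartialHomeomorph (G.piece j) G.Space :=
  (TopologicalSpace.Opens.openPartialHomeomorphSubtypeCoe ⟨G.dom j, G.isOpen_dom j⟩ h).symm.trans
    ((G.isOpenEmbedding j).toOpenPartialHomeomorph _)

@[simp] theorem incl_source (j : Option ι) [h : Nonempty (G.dom j)] :
    (G.incl j).source = G.dom j := by
  simp [incl]

theorem incl_apply (j : Option ι) [h : Nonempty (G.dom j)] (x : G.dom j) :
    G.incl j x.1 = G.proj ⟨j, x⟩ := by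
  have := (TopologicalSpace.Opens.openPartialHomeomorphSubtypeCoe
    ⟨G.dom j, G.isOpen_dom j⟩ h).left_inv (x := x) (by simp)
  simp only [incl, OpenPartialHomeomorph.coe_trans, Function.comp]
  exact congrArg (fun y => G.proj ⟨j, y⟩) this

theorem incl_self_eq {j : Option ι} [Nonempty (G.dom j)] {x y : G.piece j} (hx : x ∈ G.dom j)
    (hy : y ∈ G.dom j) : G.incl j x = G.incl j y ↔ x = y :=
  (G.incl j).injOn.eq_iff (by simpa using hx) (by simpa using hy)

/-- The transition from one piece to another is smooth. -/
theorem transition_smooth (j k : Option ι) [hj : Nonempty (G.dom j)] [hk : Nonempty (G.dom k)] :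
    ContMDiffOn I4 I4 ∞ ((G.incl j).trans (G.incl k).symm)
      ((G.incl j).trans (G.incl k).symm).source := by
  have key : ∀ x ∈ ((G.incl j).trans (G.incl k).symm).source, ∃ (hx : x ∈ G.dom j)
      (hy : ((G.incl j).trans (G.incl k).symm) x ∈ G.dom k),
      G.proj ⟨j, x, hx⟩ = G.proj ⟨k, _, hy⟩ := by
    intro x hx
    have hx1 : x ∈ G.dom j := by
      have := hx.1
      simpa using this
    have h1 : G.incl j x ∈ (G.incl k).target := hx.2
    have hy : ((G.incl j).trans (G.incl k).symm) x ∈ G.dom k := by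
      have := (G.incl k).map_target h1
      simpa using this
    refine ⟨hx1, hy, ?_⟩
    have h2 := (G.incl k).right_inv h1
    rw [← G.incl_apply k ⟨_, hy⟩, ← G.incl_apply j ⟨x, hx1⟩]
    exact h2.symm
  set t := (G.incl j).trans (G.incl k).symm with ht
  clear_value t
  rcases j with _ | i <;> rcases k with _ | k
  · refine contMDiffOn_id.congr fun x hx => ?_
    obtain ⟨h1, h2, h3⟩ := key x hx
    have := congrArg Subtype.val (G.proj_self.1 h3)
    exact this.symm
  · refine (ContMDiffOn.mono (s := (G.glue k).target) (G.isDiffeo_glue k).2 fun x hx => ?_).congr fun x hx => ?_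
    · obtain ⟨h1, h2, h3⟩ := key x hx
      obtain ⟨h4, h5⟩ := G.proj_some_none.1 h3.symm
      change G.glue k (t x) = x at h5
      rw [← h5]
      exact (G.glue k).map_source h4
    · obtain ⟨h1, h2, h3⟩ := key x hx
      obtain ⟨h4, h5⟩ := G.proj_some_none.1 h3.symm
      change G.glue k (t x) = x at h5
      change t x ∈ _ at h4
      rw [← (G.glue k).left_inv h4, h5]
  · refine (ContMDiffOn.mono (s := (G.glue i).source) (G.isDiffeo_glue i).1 fun x hx => ?_).congr fun x hx => ?_
    · obtain ⟨h1, h2, h3⟩ := key x hx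
      exact (G.proj_some_none.1 h3).1
    · obtain ⟨h1, h2, h3⟩ := key x hx
      exact (G.proj_some_none.1 h3).2.symm
  · by_cases hik : i = k
    · subst hik
      refine contMDiffOn_id.congr fun x hx => ?_
      obtain ⟨h1, h2, h3⟩ := key x hx
      have := congrArg Subtype.val (G.proj_self.1 h3)
      exact this.symm
    · intro x hx
      obtain ⟨h1, h2, h3⟩ := key x hx
      exact absurd h3 (G.proj_some_ne hik _ _)

theorem mem_contDiffGroupoid {M N : Mfd4} {t : OpenPartialHomeomorph M N}
    (ht : IsDiffeo I4 I4 t) {c : OpenPartialHomeomorph M H4} (hc : c ∈ atlas H4 M)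
    {d : OpenPartialHomeomorph N H4} (hd : d ∈ atlas H4 N) :
    (c.symm.trans t).trans d ∈ contDiffGroupoid ∞ I4 := by
  have hc' : IsDiffeo I4 I4 c :=
    ⟨contMDiffOn_of_mem_maximalAtlas (IsManifold.subset_maximalAtlas hc),
      contMDiffOn_symm_of_mem_maximalAtlas (IsManifold.subset_maximalAtlas hc)⟩
  have hd' : IsDiffeo I4 I4 d :=
    ⟨contMDiffOn_of_mem_maximalAtlas (IsManifold.subset_maximalAtlas hd),
      contMDiffOn_symm_of_mem_maximalAtlas (IsManifold.subset_maximalAtlas hd)⟩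
  have h := (hc'.symm.trans ht).trans hd'
  have h2 := (IsManifold.mem_maximalAtlas_iff_contMDiffOn (I := I4) (n := ∞) _).2 h
  have := (IsManifold.mem_maximalAtlas_iff.1 h2 (OpenPartialHomeomorph.refl H4) (by simp)).2
  simpa using this

instance : ChartedSpace H4 G.Space where
  atlas := {e | ∃ (j : Option ι) (_ : Nonempty (G.dom j)), ∃ c ∈ atlas H4 (G.piece j),
    e = (G.incl j).symm.trans c}
  chartAt z :=
    haveI : Nonempty (G.dom (G.surjective_proj z).choose.1) := ⟨(G.surjective_proj z).choose.2⟩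
    (G.incl (G.surjective_proj z).choose.1).symm.trans
      (chartAt H4 (G.surjective_proj z).choose.2.1)
  mem_chart_source z := by
    obtain hz := (G.surjective_proj z).choose_spec
    set a := (G.surjective_proj z).choose
    have : Nonempty (G.dom a.1) := ⟨a.2⟩
    have h1 : G.incl a.1 a.2.1 = z := by rw [incl_apply]; exact hz
    have h2 : a.2.1 ∈ (G.incl a.1).source := by rw [incl_source]; exact a.2.2
    rw [OpenPartialHomeomorph.trans_source]
    refine ⟨?_, ?_⟩
    · rw [← h1]
      exact (G.incl a.1).map_source h2
    · rw [mem_preimage, ← h1, (G.incl a.1).left_inv h2]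
      exact mem_chart_source _ _
  chart_mem_atlas z := ⟨_, ⟨(G.surjective_proj z).choose.2⟩, _, chart_mem_atlas _ _, rfl⟩

instance : IsManifold I4 ∞ G.Space where
  compatible := by
    rintro _ _ ⟨j, hj, c, hc, rfl⟩ ⟨k, hk, d, hd, rfl⟩
    have h : IsDiffeo I4 I4 ((G.incl j).trans (G.incl k).symm) :=
      ⟨G.transition_smooth j k, by
        have := G.transition_smooth k j
        have e : ((G.incl j).trans (G.incl k).symm).symm = (G.incl k).trans (G.incl j).symm := by
          rw [OpenPartialHomeomorph.trans_symm_eq_symm_trans_symm, OpenPartialHomeomorph.symm_symm]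
        rw [e]
        have e2 : ((G.incl j).trans (G.incl k).symm).target =
          ((G.incl k).trans (G.incl j).symm).source := by rw [← e]; rfl
        rw [e2]
        exact this⟩
    have := mem_contDiffGroupoid h hc hd
    simpa only [OpenPartialHomeomorph.trans_symm_eq_symm_trans_symm,
      OpenPartialHomeomorph.symm_symm, OpenPartialHomeomorph.trans_assoc] using this

theorem isDiffeo_incl (j : Option ι) [Nonempty (G.dom j)] : IsDiffeo I4 I4 (G.incl j) := by
  have hE : ∀ x : G.piece j, IsDiffeo I4 I4 ((G.incl j).symm.trans (chartAt H4 x)) := fun x =>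
    have h : (G.incl j).symm.trans (chartAt H4 x) ∈ atlas H4 G.Space :=
      ⟨j, inferInstance, _, chart_mem_atlas _ _, rfl⟩
    ⟨contMDiffOn_of_mem_maximalAtlas (IsManifold.subset_maximalAtlas h),
      contMDiffOn_symm_of_mem_maximalAtlas (IsManifold.subset_maximalAtlas h)⟩
  have hC : ∀ x : G.piece j, IsDiffeo I4 I4 (chartAt H4 x) := fun x =>
    ⟨contMDiffOn_of_mem_maximalAtlas (IsManifold.subset_maximalAtlas (chart_mem_atlas _ _)),
      contMDiffOn_symm_of_mem_maximalAtlas (IsManifold.subset_maximalAtlas (chart_mem_atlas _ _))⟩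
  constructor
  · intro x hx
    have h := (((hC x).trans (hE x).symm).1.contMDiffAt (x := x)
      (OpenPartialHomeomorph.open_source _ |>.mem_nhds (by simp; simpa using hx)))
    refine (h.congr_of_eventuallyEq ?_).contMDiffWithinAt
    filter_upwards [(chartAt H4 x).open_source.mem_nhds (mem_chart_source H4 x)] with y hy
    simp [(chartAt H4 x).left_inv hy]
  · intro z hz
    set x := (G.incl j).symm z with hx
    have h := (((hE x).trans (hC x).symm).1.contMDiffAt (x := z)
      (OpenPartialHomeomorph.open_source _ |>.mem_nhds (by simp [hz, ← hx])))
    refine (h.congr_of_eventuallyEq ?_).contMDiffWithinAt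
    filter_upwards [(((G.incl j).symm.trans (chartAt H4 x)).open_source).mem_nhds
      (by simp [hz, ← hx])] with y hy
    simp at hy
    simp [(chartAt H4 x).left_inv hy.2]

theorem sep_of_isOpen {j k : Option ι} {x : G.dom j} {y : G.dom k} {U : Set (G.piece j)}
    {V : Set (G.piece k)} (hU : IsOpen U) (hV : IsOpen V) (hx : x.1 ∈ U) (hy : y.1 ∈ V)
    (h : ∀ (x' : G.dom j) (y' : G.dom k), x'.1 ∈ U → y'.1 ∈ V → G.proj ⟨j, x'⟩ ≠ G.proj ⟨k, y'⟩) :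
    ∃ A B : Set G.Space, IsOpen A ∧ IsOpen B ∧ G.proj ⟨j, x⟩ ∈ A ∧ G.proj ⟨k, y⟩ ∈ B ∧
      Disjoint A B := by
  refine ⟨_, _, (G.isOpenEmbedding j).isOpenMap _ (hU.preimage continuous_subtype_val),
    (G.isOpenEmbedding k).isOpenMap _ (hV.preimage continuous_subtype_val), ⟨x, hx, rfl⟩,
    ⟨y, hy, rfl⟩, ?_⟩
  rw [Set.disjoint_left]
  rintro _ ⟨x', hx', rfl⟩ ⟨y', hy', h'⟩
  exact h x' y' hx' hy' h'.symm

instance : T2Space G.Space where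
  t2 := by
    have same : ∀ (j : Option ι) (x y : G.dom j), x ≠ y → ∃ A B : Set G.Space, IsOpen A ∧
        IsOpen B ∧ G.proj ⟨j, x⟩ ∈ A ∧ G.proj ⟨j, y⟩ ∈ B ∧ Disjoint A B := by
      intro j x y hxy
      obtain ⟨U, V, hU, hV, hx, hy, hUV⟩ := t2_separation (fun h => hxy (Subtype.ext h))
      refine G.sep_of_isOpen hU hV hx hy fun x' y' hx' hy' h => ?_
      rw [proj_self] at h
      exact Set.disjoint_left.1 hUV hx' (h ▸ hy')
    have mixed : ∀ (i : ι) (x : G.dom (some i)) (c : G.dom none),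
        G.proj ⟨some i, x⟩ ≠ G.proj ⟨none, c⟩ → ∃ A B : Set G.Space, IsOpen A ∧
        IsOpen B ∧ G.proj ⟨some i, x⟩ ∈ A ∧ G.proj ⟨none, c⟩ ∈ B ∧ Disjoint A B := by
      intro i x c hxc
      by_cases h1 : x.1 ∈ (G.glue i).source
      · have e : G.proj ⟨some i, x⟩ = G.proj ⟨none, ⟨G.glue i x.1,
          G.target_subset i ((G.glue i).map_source h1)⟩⟩ := G.proj_some_none.2 ⟨h1, rfl⟩
        rw [e] at hxc ⊢
        exact same none _ _ fun h => hxc (G.proj_self.2 h)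
      · by_cases h2 : c.1 ∈ (G.glue i).target
        · have e : G.proj ⟨some i, ⟨(G.glue i).symm c.1,
            G.source_subset i ((G.glue i).map_target h2)⟩⟩ = G.proj ⟨none, c⟩ :=
            G.proj_some_none.2 ⟨(G.glue i).map_target h2, (G.glue i).right_inv h2⟩
          rw [← e] at hxc ⊢
          exact same (some i) _ _ fun h => hxc (G.proj_self.2 h)
        · obtain ⟨U, V, hU, hV, hx, hc, h⟩ := G.separated i x.1 x.2 h1 c.1 c.2 h2
          refine G.sep_of_isOpen hU hV hx hc fun x' y' hx' hy' h' => ?_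
          obtain ⟨h3, h4⟩ := G.proj_some_none.1 h'
          exact h x'.1 ⟨hx', h3⟩ (h4 ▸ hy')
    intro z w hzw
    obtain ⟨⟨j, x⟩, rfl⟩ := G.surjective_proj z
    obtain ⟨⟨k, y⟩, rfl⟩ := G.surjective_proj w
    rcases j with _ | i <;> rcases k with _ | k
    · exact same _ _ _ fun h => hzw (G.proj_self.2 h)
    · obtain ⟨A, B, hA, hB, hx, hy, hAB⟩ := mixed k y x hzw.symm
      exact ⟨B, A, hB, hA, hy, hx, hAB.symm⟩
    · exact mixed i x y hzw
    · by_cases hik : i = k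
      · subst hik
        exact same _ _ _ fun h => hzw (G.proj_self.2 h)
      · exact G.sep_of_isOpen isOpen_univ isOpen_univ (mem_univ _) (mem_univ _)
          fun x' y' _ _ => G.proj_some_ne hik x' y'

/-- The manifold obtained by gluing. -/
abbrev result : Mfd4 where
  carrier := G.Space

end Gluing
/-! ### Circles, spheres and collars -/

attribute [local instance] finrank_real_complex_fact'

section Lift

variable {E : Type*} [NormedAddCommGroup E] [InnerProductSpace ℝ E]
  {F : Type*} [NormedAddCommGroup F] [NormedSpace ℝ F]
  {H : Type*} [TopologicalSpace H] {I : ModelWithCorners ℝ F H}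
  {M : Type*} [TopologicalSpace M] [ChartedSpace H M] [IsManifold I ∞ M]

theorem contMDiffOn_sphere {n : ℕ} [Fact (Module.finrank ℝ E = n + 1)] {s : Set M}
    {f : M → sphere (0 : E) 1} (hf : ContMDiffOn I 𝓘(ℝ, E) ∞ (fun x => (f x : E)) s) :
    ContMDiffOn I (𝓡 n) ∞ f s := by
  have : IsManifold (𝓡 n) ∞ (sphere (0 : E) 1) := IsManifold.of_le (n := ω) le_top
  rw [contMDiffOn_iff_target]
  refine ⟨Topology.IsInducing.subtypeVal.continuousOn_iff.2 hf.continuousOn, ?_⟩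
  intro v
  let U : _ ≃ₗᵢ[ℝ] _ :=
        (OrthonormalBasis.fromOrthogonalSpanSingleton (𝕜 := ℝ)
        n (ne_zero_of_mem_unit_sphere (-v))).repr
  have h : ContDiffOn ℝ ω _ Set.univ := U.contDiff.contDiffOn
  have H₁ := (h.comp_inter (contDiffOn_stereoToFun (v := (((-v : sphere (0 : E) 1) : E))))).contMDiffOn
  convert! (H₁.of_le le_top).comp' hf using 1
  ext x
  have hfxv : (f x : E) = -↑v ↔ inner ℝ (f x : E) (-↑v) = 1 := by
    have hfx : ‖(f x : E)‖ = 1 := by simp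
    rw [inner_eq_one_iff_of_norm_eq_one hfx]
    exact norm_eq_of_mem_sphere (-v)
  simp [chartAt, ChartedSpace.chartAt, Subtype.ext_iff, hfxv, real_inner_comm]

theorem contMDiffOn_circle {s : Set M} {f : M → Circle}
    (hf : ContMDiffOn I 𝓘(ℝ, ℂ) ∞ (fun x => (f x : ℂ)) s) : ContMDiffOn I (𝓡 1) ∞ f s :=
  contMDiffOn_sphere (E := ℂ) (n := 1) (f := f) hf

end Lift

instance : IsManifold (𝓡 1) ∞ Circle := IsManifold.of_le (n := ω) le_top

theorem contMDiff_circle_coe : ContMDiff (𝓡 1) 𝓘(ℝ, ℂ) ∞ (fun s : Circle => (s : ℂ)) :=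
  contMDiff_coe_sphere (E := ℂ) (n := 1)

theorem contMDiff_circle_zpow (k : ℤ) : ContMDiff (𝓡 1) (𝓡 1) ∞ (fun s : Circle => s ^ k) := by
  have : LieGroup (𝓡 1) ∞ Circle := LieGroup.of_le (n := ω) le_top
  have : ContMDiffMul (𝓡 1) ∞ Circle := inferInstance
  rcases k with k | k
  · simpa using contMDiff_id.pow k
  · simpa using (contMDiff_id.pow (k + 1)).inv

/-- The direction `z / |z|` of a nonzero complex number (with the junk value `1` at `z = 0`). -/
def dir (z : ℂ) : Circle := Circle.exp z.arg

theorem coe_dir {z : ℂ} (hz : z ≠ 0) : (dir z : ℂ) = (‖z‖⁻¹ : ℝ) • z := by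
  rw [dir, Circle.coe_exp]
  conv_rhs => rw [← Complex.norm_mul_exp_arg_mul_I z]
  have : (‖z‖ : ℂ) ≠ 0 := by exact_mod_cast norm_ne_zero_iff.2 hz
  simp
  field_simp
  rw [mul_comm, Complex.norm_mul_exp_arg_mul_I]

theorem norm_smul_dir (z : ℂ) : ‖z‖ • (dir z : ℂ) = z := by
  by_cases hz : z = 0
  · simp [hz]
  · rw [coe_dir hz, smul_smul, mul_inv_cancel₀ (norm_ne_zero_iff.2 hz), one_smul]

theorem dir_smul {r : ℝ} (hr : 0 < r) (s : Circle) : dir (r • (s : ℂ)) = s := by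
  have h : r • (s : ℂ) ≠ 0 := by simp [hr.ne']
  ext
  rw [coe_dir h, norm_smul, Circle.norm_coe, mul_one, smul_smul, Real.norm_of_nonneg hr.le,
    inv_mul_cancel₀ hr.ne', one_smul]

theorem contMDiffOn_dir : ContMDiffOn 𝓘(ℝ, ℂ) (𝓡 1) ∞ dir {z | z ≠ 0} := by
  apply contMDiffOn_circle
  have : ContDiffOn ℝ ∞ (fun z : ℂ => (‖z‖⁻¹ : ℝ) • z) {z | z ≠ 0} := by
    intro z hz
    exact (((contDiffAt_norm ℝ hz).inv (norm_ne_zero_iff.2 hz)).smul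
      contDiffAt_id).contDiffWithinAt
  exact this.contMDiffOn.congr fun z hz => coe_dir hz

theorem isOpen_ne_zero : IsOpen {z : ℂ | z ≠ 0} := isOpen_ne


/-- The map of `S¹ × (ℂ ∖ 0)` given by `(s, |y| τ) ↦ (s ^ b τ ^ d, |y| s ^ a τ ^ c)`. -/
def twistFun (a b c d : ℤ) (p : Circle × ℂ) : Circle × ℂ :=
  (p.1 ^ b * dir p.2 ^ d, ‖p.2‖ • ((p.1 ^ a * dir p.2 ^ c : Circle) : ℂ))

theorem norm_twistFun (a b c d : ℤ) (p : Circle × ℂ) : ‖(twistFun a b c d p).2‖ = ‖p.2‖ := by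
  rw [twistFun, norm_smul, Circle.norm_coe, mul_one, norm_norm]

theorem twistFun_twistFun {a b c d : ℤ} (h : a * d - b * c = 1) {p : Circle × ℂ}
    (hp : p.2 ≠ 0) : twistFun a (-c) (-b) d (twistFun a b c d p) = p := by
  have hd : dir (twistFun a b c d p).2 = p.1 ^ a * dir p.2 ^ c :=
    dir_smul (norm_pos_iff.2 hp) _
  have e1 : (p.1 ^ b * dir p.2 ^ d) ^ (-c) * (p.1 ^ a * dir p.2 ^ c) ^ d = p.1 := by
    simp only [mul_zpow, ← zpow_mul]
    calc _ = p.1 ^ (b * -c) * p.1 ^ (a * d) * (dir p.2 ^ (d * -c) * dir p.2 ^ (c * d)) := by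
          ac_rfl
      _ = p.1 := by
          rw [← zpow_add, ← zpow_add, show b * -c + a * d = 1 by linarith,
            show d * -c + c * d = 0 by ring, zpow_one, zpow_zero, mul_one]
  have e2 : (p.1 ^ b * dir p.2 ^ d) ^ a * (p.1 ^ a * dir p.2 ^ c) ^ (-b) = dir p.2 := by
    simp only [mul_zpow, ← zpow_mul]
    calc _ = p.1 ^ (b * a) * p.1 ^ (a * -b) * (dir p.2 ^ (d * a) * dir p.2 ^ (c * -b)) := by
          ac_rfl
      _ = dir p.2 := by
          rw [← zpow_add, ← zpow_add, show d * a + c * -b = 1 by linarith,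
            show b * a + a * -b = 0 by ring, zpow_one, zpow_zero, one_mul]
  refine Prod.ext ?_ ?_
  · change (p.1 ^ b * dir p.2 ^ d) ^ (-c) * dir (twistFun a b c d p).2 ^ d = p.1
    rw [hd, e1]
  · change ‖(twistFun a b c d p).2‖ •
      (((p.1 ^ b * dir p.2 ^ d) ^ a * dir (twistFun a b c d p).2 ^ (-b) : Circle) : ℂ) = p.2
    rw [hd, e2, norm_twistFun, norm_smul_dir]

theorem contMDiffOn_twistFun (a b c d : ℤ) :
    ContMDiffOn ((𝓡 1).prod 𝓘(ℝ, ℂ)) ((𝓡 1).prod 𝓘(ℝ, ℂ)) ∞ (twistFun a b c d)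
      (univ ×ˢ {z | z ≠ 0}) := by
  have : LieGroup (𝓡 1) ∞ Circle := LieGroup.of_le (n := ω) le_top
  have : ContMDiffMul (𝓡 1) ∞ Circle := inferInstance
  have h1 : ∀ k : ℤ, ContMDiffOn ((𝓡 1).prod 𝓘(ℝ, ℂ)) (𝓡 1) ∞
      (fun p : Circle × ℂ => p.1 ^ k) (univ ×ˢ {z | z ≠ 0}) := fun k =>
    ((contMDiff_circle_zpow k).comp contMDiff_fst).contMDiffOn
  have h2 : ∀ k : ℤ, ContMDiffOn ((𝓡 1).prod 𝓘(ℝ, ℂ)) (𝓡 1) ∞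
      (fun p : Circle × ℂ => dir p.2 ^ k) (univ ×ˢ {z | z ≠ 0}) := fun k =>
    (contMDiff_circle_zpow k).comp_contMDiffOn
      (contMDiffOn_dir.comp contMDiff_snd.contMDiffOn fun p hp => hp.2)
  have h3 : ContMDiffOn ((𝓡 1).prod 𝓘(ℝ, ℂ)) 𝓘(ℝ, ℝ) ∞
      (fun p : Circle × ℂ => ‖p.2‖) (univ ×ˢ {z | z ≠ 0}) := by
    have : ContDiffOn ℝ ∞ (fun z : ℂ => ‖z‖) {z | z ≠ 0} := fun z hz =>
      (contDiffAt_norm ℝ hz).contDiffWithinAt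
    exact this.contMDiffOn.comp contMDiff_snd.contMDiffOn fun p hp => hp.2
  exact ((h1 b).mul (h2 d)).prodMk
    (h3.smul (contMDiff_circle_coe.comp_contMDiffOn ((h1 a).mul (h2 c))))

/-- For `a d - b c = 1`, the diffeomorphism `(s, |y| τ) ↦ (s ^ b τ ^ d, |y| s ^ a τ ^ c)` of
`S¹ × (ℂ ∖ 0)`. If `S¹ × ℂ` is viewed as a tubular neighbourhood of a framed knot with longitude
`λ = {(s, 1)}` and meridian `μ = {(1, τ)}`, it carries the coordinate curves `{(s, 1)}`,
`{(1, τ)}` to curves in the classes `α = a μ + b λ`, `β = c μ + d λ`. -/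
def twist (M : Matrix.SpecialLinearGroup (Fin 2) ℤ) :
    OpenPartialHomeomorph (Circle × ℂ) (Circle × ℂ) where
  toFun := twistFun (M.1 0 0) (M.1 0 1) (M.1 1 0) (M.1 1 1)
  invFun := twistFun (M.1 0 0) (-M.1 1 0) (-M.1 0 1) (M.1 1 1)
  source := univ ×ˢ {z | z ≠ 0}
  target := univ ×ˢ {z | z ≠ 0}
  map_source' p hp := ⟨trivial, by
    rw [mem_ofPred_eq, ← norm_ne_zero_iff, norm_twistFun]; exact norm_ne_zero_iff.2 hp.2⟩
  map_target' p hp := ⟨trivial, by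
    rw [mem_ofPred_eq, ← norm_ne_zero_iff, norm_twistFun]; exact norm_ne_zero_iff.2 hp.2⟩
  left_inv' p hp := twistFun_twistFun
    (by have := M.2; rw [Matrix.det_fin_two] at this; exact this) hp.2
  right_inv' p hp := by
    have := twistFun_twistFun (a := M.1 0 0) (b := -M.1 1 0) (c := -M.1 0 1) (d := M.1 1 1)
      (by have := M.2; rw [Matrix.det_fin_two] at this; linarith) hp.2
    simpa using this
  open_source := isOpen_univ.prod isOpen_ne_zero
  open_target := isOpen_univ.prod isOpen_ne_zero
  continuousOn_toFun := (contMDiffOn_twistFun _ _ _ _).continuousOn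
  continuousOn_invFun := (contMDiffOn_twistFun _ _ _ _).continuousOn

theorem isDiffeo_twist (M : Matrix.SpecialLinearGroup (Fin 2) ℤ) :
    IsDiffeo ((𝓡 1).prod 𝓘(ℝ, ℂ)) ((𝓡 1).prod 𝓘(ℝ, ℂ)) (twist M) :=
  ⟨contMDiffOn_twistFun _ _ _ _, contMDiffOn_twistFun _ _ _ _⟩

/-- The open annulus `1/2 < |z| < 1`. -/
def annulus : Set ℂ := {z | 1 / 2 < ‖z‖ ∧ ‖z‖ < 1}

theorem isOpen_annulus : IsOpen annulus :=
  (isOpen_lt continuous_const continuous_norm).inter (isOpen_lt continuous_norm continuous_const)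

theorem ne_zero_of_mem_annulus {z : ℂ} (hz : z ∈ annulus) : z ≠ 0 := by
  rintro rfl
  have := hz.1
  simp at this
  linarith

theorem contDiffOn_inv_two_mul : ContDiffOn ℝ ∞ (fun z : ℂ => (2 * z)⁻¹) annulus := by
  intro z hz
  exact ((contDiffAt_const.mul contDiffAt_id).inv
    (mul_ne_zero two_ne_zero (ne_zero_of_mem_annulus hz))).contDiffWithinAt

theorem inv_two_mul_mem {z : ℂ} (hz : z ∈ annulus) : (2 * z)⁻¹ ∈ annulus := by
  obtain ⟨h1, h2⟩ := hz
  have h0 : 0 < ‖z‖ := by linarith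
  simp only [annulus, mem_ofPred_eq, norm_inv, norm_mul, Complex.norm_ofNat]
  constructor
  · rw [← one_div]
    apply one_div_lt_one_div_of_lt <;> linarith
  · apply inv_lt_one_of_one_lt₀
    linarith

/-- The involution `z ↦ 1 / (2 z)` of the annulus `1/2 < |z| < 1`: it exchanges the two ends
(reversing the collar direction) and is complex conjugation on the circle `S¹` of directions. -/
def flip : OpenPartialHomeomorph ℂ ℂ where
  toFun z := (2 * z)⁻¹
  invFun z := (2 * z)⁻¹
  source := annulus
  target := annulus
  map_source' _ hz := inv_two_mul_mem hz
  map_target' _ hz := inv_two_mul_mem hz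
  left_inv' z hz := by
    have := ne_zero_of_mem_annulus hz
    field_simp
  right_inv' z hz := by
    have := ne_zero_of_mem_annulus hz
    field_simp
  open_source := isOpen_annulus
  open_target := isOpen_annulus
  continuousOn_toFun := contDiffOn_inv_two_mul.continuousOn
  continuousOn_invFun := contDiffOn_inv_two_mul.continuousOn

theorem isDiffeo_flip : IsDiffeo 𝓘(ℝ, ℂ) 𝓘(ℝ, ℂ) flip :=
  ⟨contDiffOn_inv_two_mul.contMDiffOn, contDiffOn_inv_two_mul.contMDiffOn⟩

theorem IsDiffeo.prod {E₁ H₁ M₁ E₂ H₂ M₂ E₃ H₃ M₃ E₄ H₄ M₄ : Type*}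
    [NormedAddCommGroup E₁] [NormedSpace ℝ E₁] [TopologicalSpace H₁] [TopologicalSpace M₁]
    [ChartedSpace H₁ M₁]
    [NormedAddCommGroup E₂] [NormedSpace ℝ E₂] [TopologicalSpace H₂] [TopologicalSpace M₂]
    [ChartedSpace H₂ M₂]
    [NormedAddCommGroup E₃] [NormedSpace ℝ E₃] [TopologicalSpace H₃] [TopologicalSpace M₃]
    [ChartedSpace H₃ M₃]
    [NormedAddCommGroup E₄] [NormedSpace ℝ E₄] [TopologicalSpace H₄] [TopologicalSpace M₄]
    [ChartedSpace H₄ M₄]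
    {I₁ : ModelWithCorners ℝ E₁ H₁} {I₂ : ModelWithCorners ℝ E₂ H₂}
    {I₃ : ModelWithCorners ℝ E₃ H₃} {I₄ : ModelWithCorners ℝ E₄ H₄}
    {e : OpenPartialHomeomorph M₁ M₂} {f : OpenPartialHomeomorph M₃ M₄}
    (he : IsDiffeo I₁ I₂ e) (hf : IsDiffeo I₃ I₄ f) :
    IsDiffeo (I₁.prod I₃) (I₂.prod I₄) (e.prod f) :=
  ⟨he.1.prodMap hf.1, he.2.prodMap hf.2⟩

/-- The model with corners of `T² × ℂ = S¹ × S¹ × ℂ`. -/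
abbrev IT : ModelWithCorners ℝ (EuclideanSpace ℝ (Fin 1) × (EuclideanSpace ℝ (Fin 1) × ℂ))
    (ModelProd (EuclideanSpace ℝ (Fin 1)) (ModelProd (EuclideanSpace ℝ (Fin 1)) ℂ)) :=
  (𝓡 1).prod ((𝓡 1).prod 𝓘(ℝ, ℂ))

/-- A framed torus of self-intersection zero with a tubular neighbourhood in a 4-manifold: a
diffeomorphism from `T² × {|z| < 1}` onto an open subset. The torus is the image of `T² × 0`. -/
structure TorusNhd (M : Mfd4) where
  map : OpenPartialHomeomorph (Circle × Circle × ℂ) M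
  source_eq : map.source = univ ×ˢ univ ×ˢ ball 0 1
  isDiffeo : IsDiffeo IT I4 map

/-- The closed tubular neighbourhood `ν`: the image of `T² × {|z| ≤ 1/2}`. -/
def TorusNhd.tube {M : Mfd4} (ν : TorusNhd M) : Set M :=
  ν.map '' (univ ×ˢ univ ×ˢ closedBall 0 (1 / 2))

theorem TorusNhd.isClosed_image {M : Mfd4} (ν : TorusNhd M) {r : ℝ} (hr : r < 1) :
    IsClosed (ν.map '' (univ ×ˢ univ ×ˢ closedBall 0 r)) := by
  apply IsCompact.isClosed
  apply IsCompact.image_of_continuousOn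
  · exact isCompact_univ.prod (isCompact_univ.prod (isCompact_closedBall _ _))
  · apply ν.map.continuousOn.mono
    rw [ν.source_eq]
    exact prod_mono_right (prod_mono_right (closedBall_subset_ball hr))

/-- A gluing map between two collars `T² × {1/2 < |z| < 1}`, reversing the collar direction. -/
structure Collar where
  map : OpenPartialHomeomorph (Circle × Circle × ℂ) (Circle × Circle × ℂ)
  source_eq : map.source = univ ×ˢ univ ×ˢ annulus
  target_eq : map.target = univ ×ˢ univ ×ˢ annulus
  isDiffeo : IsDiffeo IT IT map
  norm_eq : ∀ p ∈ map.source, 2 * ‖(map p).2.2‖ * ‖p.2.2‖ = 1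

/-- The collar map `(u, s, z) ↦ (u, s, 1 / (2 z))`: the identity of `T²`, times complex conjugation
on the circle of directions of `z`. -/
def Collar.std : Collar where
  map := (OpenPartialHomeomorph.refl Circle).prod ((OpenPartialHomeomorph.refl Circle).prod flip)
  source_eq := by simp [flip]
  target_eq := by simp [flip]
  isDiffeo := isDiffeo_refl.prod (isDiffeo_refl.prod isDiffeo_flip)
  norm_eq := by
    rintro ⟨u, s, z⟩ hp
    have : z ∈ annulus := by simpa [flip] using hp
    have := norm_ne_zero_iff.2 (ne_zero_of_mem_annulus this)
    simp [flip]
    field_simp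

/-- The collar map with homology basis `(α, β)` given by the rows of `M`: complex conjugation on the
circle of directions of `z`, followed by the identification of the coordinate circles of
`(s, z / |z|)` with `α` and `β`. -/
def Collar.ofBasis (M : Matrix.SpecialLinearGroup (Fin 2) ℤ) : Collar where
  map := Collar.std.map.trans ((OpenPartialHomeomorph.refl Circle).prod (twist M))
  source_eq := by
    ext ⟨u, s, z⟩
    simp only [OpenPartialHomeomorph.trans_source, mem_inter_iff, Collar.std.source_eq,
      mem_preimage, and_iff_left_iff_imp]
    intro h
    have := Collar.std.map.map_source (Collar.std.source_eq ▸ h)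
    rw [Collar.std.target_eq] at this
    exact ⟨trivial, trivial, ne_zero_of_mem_annulus this.2.2⟩
  target_eq := by
    ext ⟨u, s, z⟩
    have e : ∀ q, ‖(((OpenPartialHomeomorph.refl Circle).prod (twist M)).symm q).2.2‖ = ‖q.2.2‖ :=
      fun q => norm_twistFun _ _ _ _ _
    have e' := e (u, s, z)
    simp only [OpenPartialHomeomorph.trans_target, mem_inter_iff, Collar.std.target_eq,
      mem_preimage, mem_prod, mem_univ, true_and, annulus, mem_ofPred_eq]
    rw [e']
    simp only [and_iff_right_iff_imp]
    intro h
    exact ⟨trivial, trivial, ne_zero_of_mem_annulus h⟩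
  isDiffeo := Collar.std.isDiffeo.trans (isDiffeo_refl.prod (isDiffeo_twist M))
  norm_eq := by
    intro p hp
    have := Collar.std.norm_eq p hp.1
    rw [← this]
    congr 2
    exact norm_twistFun _ _ _ _ _

/-- The map gluing the collar of one framed torus to the collar of another one. -/
def collarMap {M N : Mfd4} (μ : TorusNhd M) (ν : TorusNhd N) (κ : Collar) :
    OpenPartialHomeomorph N M := (ν.map.symm.trans κ.map).trans μ.map

theorem annulus_subset : (univ ×ˢ univ ×ˢ annulus : Set (Circle × Circle × ℂ)) ⊆
    univ ×ˢ univ ×ˢ ball 0 1 := fun p hp => ⟨trivial, trivial, by simpa using hp.2.2.2⟩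

section collarMap

variable {M N : Mfd4} (μ : TorusNhd M) (ν : TorusNhd N) (κ : Collar)

theorem isDiffeo_collarMap : IsDiffeo I4 I4 (collarMap μ ν κ) :=
  (ν.isDiffeo.symm.trans κ.isDiffeo).trans μ.isDiffeo

theorem mem_collarMap_source {x : N} : x ∈ (collarMap μ ν κ).source ↔
    ∃ p : Circle × Circle × ℂ, p.2.2 ∈ annulus ∧ ν.map p = x := by
  have hs := ν.source_eq
  have hk := κ.source_eq
  have hm := μ.source_eq
  simp only [collarMap, OpenPartialHomeomorph.trans_source, OpenPartialHomeomorph.symm_source,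
    mem_inter_iff, mem_preimage]
  constructor
  · rintro ⟨⟨h1, h2⟩, -⟩
    refine ⟨ν.map.symm x, ?_, ν.map.right_inv h1⟩
    rw [hk] at h2
    exact h2.2.2
  · rintro ⟨p, hp, rfl⟩
    have hp' : p ∈ (univ ×ˢ univ ×ˢ annulus : Set (Circle × Circle × ℂ)) :=
      ⟨trivial, trivial, hp⟩
    have h1 : p ∈ ν.map.source := by rw [hs]; exact annulus_subset hp'
    have h2 : p ∈ κ.map.source := by rw [hk]; exact hp'
    have h3 : κ.map p ∈ μ.map.source := by
      rw [hm]
      have := κ.map.map_source h2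
      rw [κ.target_eq] at this
      exact annulus_subset this
    refine ⟨⟨ν.map.map_source h1, ?_⟩, ?_⟩
    · rwa [ν.map.left_inv h1]
    · change κ.map (ν.map.symm (ν.map p)) ∈ _
      rwa [ν.map.left_inv h1]

theorem collarMap_apply {p : Circle × Circle × ℂ} (hp : p.2.2 ∈ annulus) :
    collarMap μ ν κ (ν.map p) = μ.map (κ.map p) := by
  have h1 : p ∈ ν.map.source := by rw [ν.source_eq]; exact annulus_subset ⟨trivial, trivial, hp⟩
  change μ.map (κ.map (ν.map.symm (ν.map p))) = _
  rw [ν.map.left_inv h1]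

theorem mem_collarMap_target {x : M} : x ∈ (collarMap μ ν κ).target ↔
    ∃ p : Circle × Circle × ℂ, p.2.2 ∈ annulus ∧ μ.map p = x := by
  constructor
  · intro hx
    have h := (collarMap μ ν κ).map_target hx
    obtain ⟨p, hp, h2⟩ := (mem_collarMap_source μ ν κ).1 h
    have hp' : p ∈ κ.map.source := by rw [κ.source_eq]; exact ⟨trivial, trivial, hp⟩
    refine ⟨κ.map p, ?_, ?_⟩
    · have := κ.map.map_source hp'
      rw [κ.target_eq] at this
      exact this.2.2
    · rw [← collarMap_apply μ ν κ hp, h2, (collarMap μ ν κ).right_inv hx]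
  · rintro ⟨p, hp, rfl⟩
    have hp' : p ∈ κ.map.target := by rw [κ.target_eq]; exact ⟨trivial, trivial, hp⟩
    have hq : (κ.map.symm p).2.2 ∈ annulus := by
      have := κ.map.map_target hp'
      rw [κ.source_eq] at this
      exact this.2.2
    have := (collarMap μ ν κ).map_source ((mem_collarMap_source μ ν κ).2 ⟨_, hq, rfl⟩)
    rwa [collarMap_apply μ ν κ hq, κ.map.right_inv hp'] at this

theorem TorusNhd.not_mem_tube {p : Circle × Circle × ℂ} (hp : p.2.2 ∈ annulus) :
    ν.map p ∉ ν.tube := by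
  rintro ⟨q, hq, h⟩
  have h1 : p ∈ ν.map.source := by rw [ν.source_eq]; exact annulus_subset ⟨trivial, trivial, hp⟩
  have h2 : q ∈ ν.map.source := by
    rw [ν.source_eq]
    exact ⟨trivial, trivial, closedBall_subset_ball (by norm_num) hq.2.2⟩
  have := ν.map.injOn h2 h1 h
  subst this
  have h3 := hq.2.2
  have h4 := hp.1
  rw [mem_closedBall_zero_iff] at h3
  linarith

theorem collarMap_separated (D : Set M) (hD : μ.tube ⊆ D) : ∀ x ∈ ν.tubeᶜ,
    x ∉ (collarMap μ ν κ).source → ∀ c ∈ Dᶜ, c ∉ (collarMap μ ν κ).target →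
    ∃ U V, IsOpen U ∧ IsOpen V ∧ x ∈ U ∧ c ∈ V ∧
      ∀ x' ∈ U ∩ (collarMap μ ν κ).source, collarMap μ ν κ x' ∉ V := by
  intro x hx hx' c hc hc'
  have hr : (3 / 4 : ℝ) * (3 / 4) > 1 / 2 := by norm_num
  refine ⟨(ν.map '' (univ ×ˢ univ ×ˢ closedBall 0 (2 / 3)))ᶜ,
    (μ.map '' (univ ×ˢ univ ×ˢ closedBall 0 (3 / 4)))ᶜ,
    (ν.isClosed_image (by norm_num)).isOpen_compl,
    (μ.isClosed_image (by norm_num)).isOpen_compl, ?_, ?_, ?_⟩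
  · rintro ⟨p, hp, rfl⟩
    have hp2 := hp.2.2
    rw [mem_closedBall_zero_iff] at hp2
    by_cases h : ‖p.2.2‖ ≤ 1 / 2
    · exact hx ⟨p, ⟨trivial, trivial, by simpa using h⟩, rfl⟩
    · exact hx' ((mem_collarMap_source _ _ _).2 ⟨p, ⟨not_le.1 h, by linarith⟩, rfl⟩)
  · rintro ⟨p, hp, rfl⟩
    have hp2 := hp.2.2
    rw [mem_closedBall_zero_iff] at hp2
    by_cases h : ‖p.2.2‖ ≤ 1 / 2
    · exact hc (hD ⟨p, ⟨trivial, trivial, by simpa using h⟩, rfl⟩)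
    · exact hc' ((mem_collarMap_target _ _ _).2 ⟨p, ⟨not_le.1 h, by linarith⟩, rfl⟩)
  · rintro x' ⟨h1, h2⟩
    obtain ⟨p, hp, rfl⟩ := (mem_collarMap_source _ _ _).1 h2
    rw [collarMap_apply _ _ _ hp, mem_compl_iff, not_not]
    refine ⟨_, ⟨trivial, trivial, ?_⟩, rfl⟩
    have h3 : 2 / 3 < ‖p.2.2‖ := by
      by_contra h
      exact h1 ⟨p, ⟨trivial, trivial, by simpa using h⟩, rfl⟩
    have h4 := κ.norm_eq p (by rw [κ.source_eq]; exact ⟨trivial, trivial, hp⟩)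
    rw [mem_closedBall_zero_iff]
    nlinarith [norm_nonneg (κ.map p).2.2]

end collarMap

/-- Glue the manifolds `X i ∖ ν(i)`, `i : ι`, to `C ∖ ⋃ i, μ(i)` along the collars of the removed
tubular neighbourhoods; the tubular neighbourhoods `μ i` in `C` are pairwise disjoint. -/
def glueAlong {ι : Type} [Finite ι] (C : Mfd4) (X : ι → Mfd4) (μ : ι → TorusNhd C)
    (hμ : ∀ i k, i ≠ k → Disjoint (μ i).map.target (μ k).map.target)
    (ν : ∀ i, TorusNhd (X i)) (κ : ι → Collar) : Gluing ι where
  piece j := j.elim C X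
  dom j := match j with
    | none => (⋃ i, (μ i).tube)ᶜ
    | some i => ((ν i).tube)ᶜ
  isOpen_dom j := match j with
    | none => (isClosed_iUnion_of_finite
        fun i => (μ i).isClosed_image (r := 1 / 2) (by norm_num)).isOpen_compl
    | some i => ((ν i).isClosed_image (r := 1 / 2) (by norm_num)).isOpen_compl
  glue i := collarMap (μ i) (ν i) (κ i)
  source_subset i := by
    intro x hx
    obtain ⟨p, hp, rfl⟩ := (mem_collarMap_source _ _ _).1 hx
    exact TorusNhd.not_mem_tube (ν i) hp
  target_subset i := by
    intro x hx
    obtain ⟨p, hp, rfl⟩ := (mem_collarMap_target _ _ _).1 hx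
    have h1 : ∀ q ∈ (univ ×ˢ univ ×ˢ ball 0 1 : Set (Circle × Circle × ℂ)), ∀ k,
      (μ k).map q ∈ (μ k).map.target := fun q hq k => (μ k).map.map_source ((μ k).source_eq ▸ hq)
    intro hk
    obtain ⟨k, hk⟩ := mem_iUnion.1 hk
    by_cases hik : i = k
    · subst hik
      exact TorusNhd.not_mem_tube (μ i) hp hk
    · obtain ⟨q, hq, h⟩ := hk
      refine Set.disjoint_left.1 (hμ i k hik) (h1 p (annulus_subset ⟨trivial, trivial, hp⟩) i) ?_
      exact Eq.mp (congrArg (· ∈ (μ k).map.target) h)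
        (h1 q ⟨trivial, trivial, closedBall_subset_ball (by norm_num) hq.2.2⟩ k)
  isDiffeo_glue i := isDiffeo_collarMap _ _ _
  disjoint_target i k hik := by
    rw [Set.disjoint_left]
    intro x hx hx'
    exact Set.disjoint_left.1 (hμ i k hik) hx.1 hx'.1
  separated i := collarMap_separated (μ i) (ν i) (κ i) _ fun x hx => mem_iUnion.2 ⟨i, hx⟩
/-! ### Fiber sums and link surgery -/

/-- A framed torus of a piece, contained in its domain, as a framed torus in the glued manifold. -/
def TorusNhd.push {ι : Type} (G : Gluing ι) (j : Option ι) (μ : TorusNhd (G.piece j))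
    (h : μ.map.target ⊆ G.dom j) : TorusNhd G.result :=
  have h0 : ((1, 1, 0) : Circle × Circle × ℂ) ∈ μ.map.source := by
    rw [μ.source_eq]; exact ⟨trivial, trivial, by simp⟩
  have hne : Nonempty (G.dom j) := ⟨⟨_, h (μ.map.map_source h0)⟩⟩
  { map := μ.map.trans (G.incl j)
    source_eq := by
      rw [← μ.source_eq, OpenPartialHomeomorph.trans_source, G.incl_source]
      exact inter_eq_left.2 fun x hx => h (μ.map.map_source hx)
    isDiffeo := μ.isDiffeo.trans (G.isDiffeo_incl j) }

/-- A 4-manifold together with a framed torus. -/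
structure FramedMfd where
  mfd : Mfd4
  nhd : TorusNhd mfd

/-- The gluing data of a fiber sum. -/
def fiberGluing (X Y : FramedMfd) : Gluing Unit :=
  glueAlong X.mfd (fun _ => Y.mfd) (fun _ => X.nhd)
    (fun i k h => (h (Subsingleton.elim i k)).elim) (fun _ => Y.nhd) (fun _ => Collar.std)

/-- The fiber sum of `X` and `Y` along framed tori: the complements of their tubular neighbourhoods
are glued so that the tori are identified through their parametrizations by `T²`, with complex
conjugation on the circles normal to the tori. -/
def fiberSum (X Y : FramedMfd) : Mfd4 := (fiberGluing X Y).result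

/-- A framed torus of the first summand, disjoint from the one used for the fiber sum, as a framed
torus in the fiber sum. -/
def TorusNhd.inFiberSum {M : Mfd4} (μ₀ μ : TorusNhd M) (Y : FramedMfd)
    (h : Disjoint μ₀.map.target μ.map.target) : TorusNhd (fiberSum ⟨M, μ⟩ Y) :=
  TorusNhd.push (fiberGluing ⟨M, μ⟩ Y) none μ₀ (by
    intro x hx hx'
    obtain ⟨i, q, hq, e⟩ := mem_iUnion.1 hx'
    refine Set.disjoint_left.1 h hx (Eq.mp (congrArg (· ∈ μ.map.target) e) (μ.map.map_source ?_))
    rw [μ.source_eq]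
    exact ⟨trivial, trivial, closedBall_subset_ball (by norm_num) hq.2.2⟩)

instance : Fact (Module.finrank ℝ (EuclideanSpace ℂ (Fin 2)) = 3 + 1) := ⟨by
  have h := Module.finrank_mul_finrank ℝ ℂ (EuclideanSpace ℂ (Fin 2))
  rw [Complex.finrank_real_complex, finrank_euclideanSpace_fin] at h
  omega⟩

/-- The unit sphere of `ℂ²`. -/
abbrev S3 : Type := sphere (0 : EuclideanSpace ℂ (Fin 2)) 1

instance : IsManifold (𝓡 3) ∞ S3 := IsManifold.of_le (n := ω) le_top

/-- The product `S¹ × S³`. -/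
def circleTimesS3 : Mfd4 where
  carrier := Circle × S3

/-- A tubular neighbourhood of a smooth knot in `S³`: a diffeomorphism from `S¹ × {|z| < 1}` onto an
open subset. The knot is the image of `S¹ × 0`. -/
structure KnotTube where
  map : OpenPartialHomeomorph (Circle × ℂ) S3
  source_eq : map.source = univ ×ˢ ball 0 1
  isDiffeo : IsDiffeo ((𝓡 1).prod 𝓘(ℝ, ℂ)) (𝓡 3) map

/-- The framed torus `S¹ × K` in `S¹ × S³`. -/
def KnotTube.torus (K : KnotTube) : TorusNhd circleTimesS3 where
  map := (OpenPartialHomeomorph.refl Circle).prod K.map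
  source_eq := by simp [K.source_eq]
  isDiffeo := isDiffeo_refl.prod K.isDiffeo

theorem KnotTube.torus_disjoint {K L : KnotTube} (h : Disjoint K.map.target L.map.target) :
    Disjoint K.torus.map.target L.torus.map.target := by
  rw [Set.disjoint_left] at h ⊢
  intro x hx hx'
  exact h hx.2 hx'.2

/-- The link surgery manifold obtained from 4-manifolds `X i` with framed tori and a link `L` in
`S³` with tubular neighbourhoods `K i`: the complements of the tori in `X i` are glued to
`S¹ × (S³ ∖ ν(L))` so that the torus in `X i` is identified with `S¹ × α i` and the normal circle
of the torus with `β i`, by complex conjugation. Here `(α i, β i)` is the homology basis of the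
`i`-th boundary torus of the link exterior with coordinates given by the rows of `M i` in the basis
`(μ, λ)` of meridian and longitude defined by `K i`; as `det (M i) = 1`, the intersection number
`α i · β i` is equal to `μ · λ = 1` (for the orientation of the torus as boundary of `ν(L)`, if
`K i` preserves orientations). -/
def linkSurgery {ι : Type} [Finite ι] (X : ι → FramedMfd)
    (K : ι → KnotTube) (hK : ∀ i k, i ≠ k → Disjoint (K i).map.target (K k).map.target)
    (M : ι → Matrix.SpecialLinearGroup (Fin 2) ℤ) : Mfd4 :=
  (glueAlong circleTimesS3 (fun i => (X i).mfd) (fun i => (K i).torus)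
    (fun i k h => KnotTube.torus_disjoint (hK i k h)) (fun i => (X i).nhd) (fun i => Collar.ofBasis (M i))).result

/-! ### The axis, closed braids and the tori `T_{p,q}` -/

theorem norm_sq_S3 (i : Fin 2) (x : S3) : ‖x.1 i‖ ^ 2 + ‖x.1 (i + 1)‖ ^ 2 = 1 := by
  have h : ‖x.1‖ = 1 := by simp
  have h2 := EuclideanSpace.norm_sq_eq x.1
  rw [h, Fin.sum_univ_two] at h2
  fin_cases i
  · simpa using h2.symm
  · simpa [add_comm] using h2.symm

/-- The point of `S³` in the direction of the vector with `i`-th coordinate `l` and other coordinate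
`w`. -/
def solidFun (i : Fin 2) (p : Circle × ℂ) : S3 :=
  ⟨((√(1 + ‖p.2‖ ^ 2))⁻¹ : ℝ) •
    (WithLp.toLp 2 (fun k => if k = i then (p.1 : ℂ) else p.2) : EuclideanSpace ℂ (Fin 2)), by
    have h : ‖(WithLp.toLp 2 (fun k => if k = i then (p.1 : ℂ) else p.2) :
        EuclideanSpace ℂ (Fin 2))‖ = √(1 + ‖p.2‖ ^ 2) := by
      rw [EuclideanSpace.norm_eq, Fin.sum_univ_two]
      congr 1
      fin_cases i
      · simp [Circle.norm_coe]
      · simp [Circle.norm_coe, add_comm]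
    have h0 : (0 : ℝ) < √(1 + ‖p.2‖ ^ 2) := by positivity
    rw [mem_sphere_zero_iff_norm, norm_smul, h, Real.norm_of_nonneg (by positivity),
      inv_mul_cancel₀ h0.ne']⟩

def solidInv (i : Fin 2) (x : S3) : Circle × ℂ :=
  (dir (x.1 i), (‖x.1 i‖⁻¹ : ℝ) • x.1 (i + 1))

theorem contMDiff_solidFun (i : Fin 2) :
    ContMDiff ((𝓡 1).prod 𝓘(ℝ, ℂ)) (𝓡 3) ∞ (solidFun i) := by
  rw [← contMDiffOn_univ]
  apply contMDiffOn_sphere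
  have h1 : ContDiff ℝ ∞ (fun p : ℂ × ℂ => ((√(1 + ‖p.2‖ ^ 2))⁻¹ : ℝ) •
    (WithLp.toLp 2 (fun k => if k = i then p.1 else p.2) : EuclideanSpace ℂ (Fin 2))) := by
    refine ContDiff.fun_smul ?_ ?_
    · apply ContDiff.inv
      · apply ContDiff.sqrt
        · exact contDiff_const.add (contDiff_snd.norm_sq ℝ)
        · intro p; positivity
      · intro p
        have : (0 : ℝ) < √(1 + ‖p.2‖ ^ 2) := by positivity
        exact this.ne'
    · apply (PiLp.contDiff_toLp (𝕜 := ℝ) (n := ∞)).comp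
      rw [contDiff_pi]
      intro k
      by_cases h : k = i
      · simpa [h] using contDiff_fst
      · simpa [h] using contDiff_snd
  exact (h1.contMDiff.comp
    ((contMDiff_circle_coe.comp contMDiff_fst).prodMk_space contMDiff_snd)).contMDiffOn

theorem contMDiffOn_solidInv (i : Fin 2) :
    ContMDiffOn (𝓡 3) ((𝓡 1).prod 𝓘(ℝ, ℂ)) ∞ (solidInv i) {x | x.1 i ≠ 0} := by
  have hc : ∀ k, ContMDiff (𝓡 3) 𝓘(ℝ, ℂ) ∞ (fun x : S3 => x.1 k) := by
    intro k
    have h1 : ContDiff ℝ ∞ (fun v : EuclideanSpace ℂ (Fin 2) => v k) := by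
      exact contDiff_piLp_apply (ι := Fin 2) (E := fun _ => ℂ) (p := 2)
    exact h1.contMDiff.comp (contMDiff_coe_sphere (n := 3))
  have hn : ContMDiffOn (𝓡 3) 𝓘(ℝ, ℝ) ∞ (fun x : S3 => ‖x.1 i‖⁻¹) {x | x.1 i ≠ 0} := by
    have : ContDiffOn ℝ ∞ (fun z : ℂ => ‖z‖⁻¹) {z | z ≠ 0} := fun z hz =>
      ((contDiffAt_norm ℝ hz).inv (norm_ne_zero_iff.2 hz)).contDiffWithinAt
    exact this.contMDiffOn.comp (hc i).contMDiffOn fun p hp => hp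
  exact (contMDiffOn_dir.comp (hc i).contMDiffOn fun p hp => hp).prodMk
    (hn.smul (hc (i + 1)).contMDiffOn)

/-- The identification of `S¹ × ℂ` with the complement of the circle `{x i = 0}` in `S³`, a
diffeomorphism `(l, w) ↦ (l, w) / √(1 + |w|²)` (with `l` as `i`-th coordinate). -/
def solid (i : Fin 2) : OpenPartialHomeomorph (Circle × ℂ) S3 where
  toFun := solidFun i
  invFun := solidInv i
  source := univ
  target := {x | x.1 i ≠ 0}
  map_source' p _ := by
    have h0 : (0 : ℝ) < √(1 + ‖p.2‖ ^ 2) := by positivity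
    simp [solidFun, h0.ne']
  map_target' _ _ := trivial
  left_inv' p _ := by
    have h0 : (0 : ℝ) < √(1 + ‖p.2‖ ^ 2) := by positivity
    have e1 : (solidFun i p).1 i = (√(1 + ‖p.2‖ ^ 2))⁻¹ • (p.1 : ℂ) := by simp [solidFun]
    have e2 : (solidFun i p).1 (i + 1) = (√(1 + ‖p.2‖ ^ 2))⁻¹ • p.2 := by simp [solidFun]
    refine Prod.ext ?_ ?_
    · change dir ((solidFun i p).1 i) = _
      rw [e1]
      exact dir_smul (inv_pos.2 h0) _
    · change (‖(solidFun i p).1 i‖⁻¹ : ℝ) • (solidFun i p).1 (i + 1) = _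
      rw [e1, e2, norm_smul, Circle.norm_coe, mul_one, Real.norm_of_nonneg (inv_pos.2 h0).le,
        inv_inv, smul_smul, mul_inv_cancel₀ h0.ne', one_smul]
  right_inv' x hx := by
    have hn : (0 : ℝ) < ‖x.1 i‖ := norm_pos_iff.2 hx
    have h := norm_sq_S3 i x
    have e : √(1 + ‖(solidInv i x).2‖ ^ 2) = ‖x.1 i‖⁻¹ := by
      rw [Real.sqrt_eq_iff_mul_self_eq (by positivity) (by positivity)]
      simp only [solidInv, norm_smul, norm_inv, norm_norm]
      field_simp
      linarith
    ext k
    change ((√(1 + ‖(solidInv i x).2‖ ^ 2))⁻¹ : ℝ) •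
      (if k = i then ((solidInv i x).1 : ℂ) else (solidInv i x).2) = x.1 k
    rw [e, inv_inv]
    by_cases hk : k = i
    · subst hk
      simpa [solidInv] using norm_smul_dir (x.1 k)
    · have hk' : k = i + 1 := by omega
      rw [if_neg hk, hk', solidInv, smul_smul, mul_inv_cancel₀ hn.ne', one_smul]
  open_source := isOpen_univ
  open_target := by
    have hc : Continuous (fun x : S3 => x.1 i) := by fun_prop
    exact isOpen_ne_fun hc continuous_const
  continuousOn_toFun := (contMDiff_solidFun i).continuous.continuousOn
  continuousOn_invFun := (contMDiffOn_solidInv i).continuousOn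

theorem isDiffeo_solid (i : Fin 2) : IsDiffeo ((𝓡 1).prod 𝓘(ℝ, ℂ)) (𝓡 3) (solid i) :=
  ⟨(contMDiff_solidFun i).contMDiffOn, contMDiffOn_solidInv i⟩

/-- The unknot `A = {x 1 = 0}` in `S³`, with the tubular neighbourhood `{|x 1| < |x 0|}` in which
`S¹ × 1` is the longitude of `A` and `1 × S¹` its meridian. -/
def axis : KnotTube where
  map := (solid 0).restrOpen (univ ×ˢ ball 0 1) (isOpen_univ.prod isOpen_ball)
  source_eq := by simp [solid]
  isDiffeo := (isDiffeo_solid 0).restr _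

/-- The position on the real line of the `i`-th of `q` strands, `1 ≤ i ≤ q`. -/
def strandPos (q i : ℕ) : ℂ := (((i : ℝ) - (q + 1) / 2) / q : ℝ)

/-- The configuration of `q` points in the disc at time `σ ∈ [0, 1]` of the braid generator `σ_i`:
the strands in positions `i` and `i + 1` make a half twist (counterclockwise; the strand starting in
position `i + 1` passes through the upper half plane), the other ones do not move. -/
def halfTwist (q i : ℕ) (σ : ℝ) : Set ℂ :=
  {z | ∃ j, 1 ≤ j ∧ j ≤ q ∧ j ≠ i ∧ j ≠ i + 1 ∧ z = strandPos q j} ∪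
  {z | ∃ ε : ℂ, (ε = 1 ∨ ε = -1) ∧ z = (strandPos q i + strandPos q (i + 1)) / 2 +
    ε * (1 / (2 * q)) * Complex.exp (Real.pi * σ * Complex.I)}

/-- The closure, in the solid torus `S¹ × D²`, of the braid on `q` strands given by the word
`σ_{w 0} σ_{w 1} ⋯` in the positive generators. -/
def closedBraid (q : ℕ) (w : List ℕ) : Set (Circle × ℂ) :=
  {x | ∃ (k : Fin w.length) (τ : ℝ), 0 ≤ τ ∧ τ ≤ 1 ∧
    x.1 = Circle.exp (2 * Real.pi * ((k + τ) / w.length)) ∧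
    x.2 ∈ halfTwist q (w.get k) (Real.smoothTransition τ)}

/-- The braid `B_{p,q} = σ_{q-1} σ_{q-2} ⋯ σ_2 σ_1 ^ (2 p - 1)` on `q` strands. -/
def braidWord (p q : ℕ) : List ℕ :=
  (List.range (q - 2)).map (fun k => q - 1 - k) ++ List.replicate (2 * p - 1) 1

/-- The knot `B̂_{p,q}` in `S³`, the closure of `B_{p,q}` in the complement of its axis
`A = {x 1 = 0}`. -/
def braidKnot (p q : ℕ) : Set S3 := solid 1 '' closedBraid q (braidWord p q)

namespace KnotTube

variable (K : KnotTube)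

/-- The knot itself. -/
def core : Set S3 := K.map '' (univ ×ˢ {0})

/-- The tubular neighbourhood as a map `ℝ × ℂ → ℂ²`, `(θ, w) ↦ K (exp (i θ), w)`. -/
def param (x : ℝ × ℂ) : EuclideanSpace ℂ (Fin 2) := (K.map (Circle.exp x.1, x.2)).1

/-- Real coordinates of a vector in `ℂ²`. -/
def realCoord (z w : ℂ) : Fin 4 → ℝ := ![z.re, z.im, w.re, w.im]

/-- The tubular neighbourhood preserves orientations, for the orientation of `S³` as boundary of
the unit ball of `ℂ²`. -/
def PreservesOrientation : Prop :=
  ∀ x : ℝ × ℂ, x.2 ∈ ball (0 : ℂ) 1 →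
    0 < (Matrix.of fun k : Fin 4 => (fun v : EuclideanSpace ℂ (Fin 2) => realCoord (v 0) (v 1))
      (![K.param x, fderiv ℝ K.param x (1, 0), fderiv ℝ K.param x (0, 1),
        fderiv ℝ K.param x (0, Complex.I)] k)).det

/-- The parametrization of the knot turns in the positive direction around `A = {x 1 = 0}`. -/
def TurnsPositively : Prop :=
  ∀ θ : ℝ, 0 < ((starRingEnd ℂ) (K.param (θ, 0) 1) * fderiv ℝ K.param (θ, 0) (1, 0) 1).im

/-- The parallel curve `S¹ × 1/2` is a longitude: it is null-homologous in the complement of the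
knot, i.e. its class in the fundamental group is a product of commutators. -/
def IsZeroFramed : Prop :=
  ∃ (x₀ : {x : S3 // x ∉ K.core}) (γ : Path x₀ x₀),
    (∀ t : unitInterval, (γ t : S3) = K.map (Circle.exp (2 * Real.pi * t), 1 / 2)) ∧
    FundamentalGroup.fromPath (Path.Homotopic.Quotient.mk γ) ∈
      commutator (FundamentalGroup {x : S3 // x ∉ K.core} x₀)

end KnotTube

/-- `K` is a tubular neighbourhood of the knot `B̂_{p,q}`, disjoint from the one of the axis, with
the orientation of the braid and the framing given by meridian and longitude. -/
structure IsBraidTube (p q : ℕ) (K : KnotTube) : Prop where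
  core_eq : K.core = braidKnot p q
  disjoint_axis : Disjoint axis.map.target K.map.target
  preservesOrientation : K.PreservesOrientation
  turnsPositively : K.TurnsPositively
  isZeroFramed : K.IsZeroFramed

/-- The real-linear automorphism `w ↦ r * conj w` of `ℂ`, for real `r ≠ 0`. -/
def conjScale (r : ℝ) (hr : r ≠ 0) : OpenPartialHomeomorph ℂ ℂ where
  toFun w := r * (starRingEnd ℂ) w
  invFun w := r⁻¹ * (starRingEnd ℂ) w
  source := univ
  target := univ
  map_source' _ _ := trivial
  map_target' _ _ := trivial
  left_inv' w _ := by
    have : (r : ℂ) ≠ 0 := by exact_mod_cast hr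
    simp
    field_simp
  right_inv' w _ := by
    have : (r : ℂ) ≠ 0 := by exact_mod_cast hr
    simp
    field_simp
  open_source := isOpen_univ
  open_target := isOpen_univ
  continuousOn_toFun := (continuous_const.mul Complex.continuous_conj).continuousOn
  continuousOn_invFun := (continuous_const.mul Complex.continuous_conj).continuousOn

theorem isDiffeo_conjScale (r : ℝ) (hr : r ≠ 0) :
    IsDiffeo 𝓘(ℝ, ℂ) 𝓘(ℝ, ℂ) (conjScale r hr) := by
  have h : ContDiff ℝ ∞ (fun w : ℂ => (starRingEnd ℂ) w) := Complex.conjCLE.contDiff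
  exact ⟨(contDiff_const.mul h).contMDiff.contMDiffOn,
    (contDiff_const.mul h).contMDiff.contMDiffOn⟩

/-- The identification of the complement of a closed tubular neighbourhood `{|x 0| ≥ 2 |x 1|}` of
the axis with the open solid torus `S¹ × {|z| < 1}`, `x ↦ (x 1 / |x 1|, conj (x 0) / (2 |x 1|))`
(here without the restriction to `|x 0| < 2 |x 1|`): the core `S¹ × 0` is a meridian of the axis,
and the circle `1 × ∂D²` is identified with the longitude of the axis by complex conjugation. -/
def axisComplement : OpenPartialHomeomorph S3 (Circle × ℂ) :=
  (solid 1).symm.trans ((OpenPartialHomeomorph.refl Circle).prod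
    (conjScale (1 / 2) (by norm_num)))

theorem isDiffeo_axisComplement :
    IsDiffeo (𝓡 3) ((𝓡 1).prod 𝓘(ℝ, ℂ)) axisComplement :=
  (isDiffeo_solid 1).symm.trans (isDiffeo_refl.prod (isDiffeo_conjScale _ _))

/-- Given a framed torus `F` with tubular neighbourhood `ν` in a 4-manifold, identify `ν` with
`S¹ × (S³ ∖ ν(A))` so that `F = S¹ × μ(A)`. For a knot `K` in `S³ ∖ ν(A)` this is the torus `S¹ × K`
in `ν`, with the framing coming from the one of `K` (and complex conjugation on the normal discs,
to obtain the orientation given by the 4-manifold). -/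
def TorusNhd.satellite {M : Mfd4} (ν : TorusNhd M) (K : KnotTube)
    (hK : Disjoint axis.map.target K.map.target) : TorusNhd M where
  map := (((OpenPartialHomeomorph.refl Circle).prod
    (((OpenPartialHomeomorph.refl Circle).prod (conjScale 1 one_ne_zero)).trans
      (K.map.trans axisComplement))).trans ν.map)
  source_eq := by
    ext ⟨u, s, z⟩
    have hz : ‖(conjScale 1 one_ne_zero) z‖ = ‖z‖ := by simp [conjScale]
    rw [OpenPartialHomeomorph.trans_source, ν.source_eq]
    simp only [OpenPartialHomeomorph.prod_source, OpenPartialHomeomorph.refl_source,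
      OpenPartialHomeomorph.trans_source, mem_inter_iff, mem_prod, mem_univ, true_and,
      mem_preimage, K.source_eq, mem_ball_zero_iff, OpenPartialHomeomorph.prod_apply,
      OpenPartialHomeomorph.coe_trans, Function.comp, OpenPartialHomeomorph.refl_apply, id]
    constructor
    · rintro ⟨⟨-, h, -⟩, -⟩
      exact hz ▸ h
    · intro h
      have h1 : ((s, conjScale 1 one_ne_zero z) : Circle × ℂ) ∈ K.map.source := by
        rw [K.source_eq]
        exact ⟨trivial, by rw [mem_ball_zero_iff, hz]; exact h⟩
      set x := K.map (s, conjScale 1 one_ne_zero z) with hx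
      have h2 : x ∉ axis.map.target := fun h' => Set.disjoint_left.1 hK h' (K.map.map_source h1)
      have h3 : ‖x.1 0‖ ≤ ‖x.1 1‖ := by
        by_contra h4
        rw [not_le] at h4
        apply h2
        have h5 : (0 : ℝ) < ‖x.1 0‖ := (norm_nonneg _).trans_lt h4
        refine ⟨norm_pos_iff.1 h5, trivial, ?_⟩
        change (‖x.1 0‖⁻¹ : ℝ) • x.1 1 ∈ ball (0 : ℂ) 1
        rw [mem_ball_zero_iff, norm_smul, norm_inv, norm_norm]
        rw [inv_mul_lt_iff₀ h5, mul_one]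
        exact h4
      have h4 : (0 : ℝ) < ‖x.1 1‖ := by
        have := norm_sq_S3 0 x
        rw [zero_add] at this
        by_contra h5
        have h6 : ‖x.1 1‖ = 0 := le_antisymm (not_lt.1 h5) (norm_nonneg _)
        have h7 : ‖x.1 0‖ = 0 := le_antisymm (h6 ▸ h3) (norm_nonneg _)
        rw [h6, h7] at this
        norm_num at this
      refine ⟨⟨trivial, by rw [hz]; exact h, ?_⟩, ?_⟩
      · exact ⟨norm_pos_iff.1 h4, trivial, trivial⟩
      · change ‖((1 / 2 : ℝ) : ℂ) * (starRingEnd ℂ) ((‖x.1 1‖⁻¹ : ℝ) • x.1 0)‖ < 1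
        rw [norm_mul, RCLike.norm_conj, norm_smul, norm_inv, norm_norm]
        have h5 : ‖x.1 1‖⁻¹ * ‖x.1 0‖ ≤ 1 := by
          rw [inv_mul_le_iff₀ h4, mul_one]
          exact h3
        have h6 : ‖((1 / 2 : ℝ) : ℂ)‖ = 1 / 2 := by simp
        rw [h6]
        linarith
  isDiffeo := (isDiffeo_refl.prod ((isDiffeo_refl.prod (isDiffeo_conjScale _ _)).trans
    (K.isDiffeo.trans isDiffeo_axisComplement))).trans ν.isDiffeo

/-! ### The elliptic surfaces -/

instance (n : ℕ) : TopologicalSpace (Projectivization ℂ (Fin n → ℂ)) :=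
  inferInstanceAs (TopologicalSpace (Quotient (projectivizationSetoid ℂ (Fin n → ℂ))))

section Proj

variable {n : ℕ}

theorem isQuotientMap_mk' : IsQuotientMap (Projectivization.mk' ℂ (V := Fin n → ℂ)) :=
  isQuotientMap_quotient_mk'

/-- The representative of a point of projective space with `i`-th coordinate `1`, if it exists. -/
def ratio (i : Fin n) (x : Projectivization ℂ (Fin n → ℂ)) : Fin n → ℂ := (x.rep i)⁻¹ • x.rep

theorem ratio_mk (i : Fin n) (v : Fin n → ℂ) (hv : v ≠ 0) :
    ratio i (Projectivization.mk ℂ v hv) = (v i)⁻¹ • v := by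
  obtain ⟨a, ha⟩ := Projectivization.exists_smul_eq_mk_rep ℂ v hv
  rw [ratio, ← ha]
  ext j
  have := a.ne_zero
  simp only [Pi.smul_apply, Units.smul_def, smul_eq_mul, mul_inv]
  field_simp

theorem rep_mk_ne (i : Fin n) (v : Fin n → ℂ) (hv : v ≠ 0) :
    (Projectivization.mk ℂ v hv).rep i ≠ 0 ↔ v i ≠ 0 := by
  obtain ⟨a, ha⟩ := Projectivization.exists_smul_eq_mk_rep ℂ v hv
  rw [← ha]
  simp [Units.smul_def]

theorem isOpen_rep_ne (i : Fin n) :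
    IsOpen {x : Projectivization ℂ (Fin n → ℂ) | x.rep i ≠ 0} := by
  rw [← isQuotientMap_mk'.isOpen_preimage]
  have : Projectivization.mk' ℂ ⁻¹' {x : Projectivization ℂ (Fin n → ℂ) | x.rep i ≠ 0} =
      {v | v.1 i ≠ 0} := by
    ext v
    exact rep_mk_ne i v.1 v.2
  rw [this]
  exact isOpen_ne_fun ((continuous_apply i).comp continuous_subtype_val) continuous_const

theorem continuousOn_ratio (i : Fin n) :
    ContinuousOn (ratio i) {x : Projectivization ℂ (Fin n → ℂ) | x.rep i ≠ 0} := by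
  rw [isQuotientMap_mk'.continuousOn_isOpen_iff (isOpen_rep_ne i)]
  have h : ContinuousOn (fun v : {v : Fin n → ℂ // v ≠ 0} => (v.1 i)⁻¹ • v.1)
      (Projectivization.mk' ℂ ⁻¹' {x : Projectivization ℂ (Fin n → ℂ) | x.rep i ≠ 0}) := by
    refine ContinuousOn.fun_smul (ContinuousOn.inv₀
      ((continuous_apply i).comp continuous_subtype_val).continuousOn fun v hv => ?_)
      continuous_subtype_val.continuousOn
    exact (rep_mk_ne i v.1 v.2).1 hv
  exact h.congr fun v hv => ratio_mk i v.1 v.2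

instance : T2Space (Projectivization ℂ (Fin n → ℂ)) := by
  let ρ : Projectivization ℂ (Fin n → ℂ) → Fin n → Fin n → ℂ := fun x a b =>
    x.rep a * (starRingEnd ℂ) (x.rep b) / ∑ k, x.rep k * (starRingEnd ℂ) (x.rep k)
  have hs : ∀ v : Fin n → ℂ, v ≠ 0 → ∑ k, v k * (starRingEnd ℂ) (v k) ≠ 0 := by
    intro v hv h
    simp only [Complex.mul_conj] at h
    have h2 : ∑ k, Complex.normSq (v k) = 0 := by exact_mod_cast h
    rw [Finset.sum_eq_zero_iff_of_nonneg fun k _ => Complex.normSq_nonneg _] at h2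
    exact hv (funext fun k => Complex.normSq_eq_zero.1 (h2 k (Finset.mem_univ k)))
  have hmk : ∀ (v : Fin n → ℂ) (hv : v ≠ 0), ρ (Projectivization.mk ℂ v hv) = fun a b =>
      v a * (starRingEnd ℂ) (v b) / ∑ k, v k * (starRingEnd ℂ) (v k) := by
    intro v hv
    obtain ⟨a, ha⟩ := Projectivization.exists_smul_eq_mk_rep ℂ v hv
    have h0 := a.ne_zero
    have h0' : (starRingEnd ℂ) (a : ℂ) ≠ 0 := by simp
    have h1 := hs v hv
    ext i j
    simp only [ρ, ← ha, Units.smul_def, Pi.smul_apply, smul_eq_mul, map_mul]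
    have e : ∑ k, (a : ℂ) * v k * ((starRingEnd ℂ) (a : ℂ) * (starRingEnd ℂ) (v k)) =
        (a : ℂ) * (starRingEnd ℂ) (a : ℂ) * ∑ k, v k * (starRingEnd ℂ) (v k) := by
      rw [Finset.mul_sum]
      exact Finset.sum_congr rfl fun k _ => by ring
    rw [e]
    field_simp
  have hc : Continuous ρ := by
    rw [isQuotientMap_mk'.continuous_iff]
    have hk : ∀ k, Continuous (fun v : {v : Fin n → ℂ // v ≠ 0} => v.1 k) := fun k =>
      (continuous_apply k).comp continuous_subtype_val
    have : Continuous (fun v : {v : Fin n → ℂ // v ≠ 0} => fun a b =>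
      v.1 a * (starRingEnd ℂ) (v.1 b) / ∑ k, v.1 k * (starRingEnd ℂ) (v.1 k)) := by
      refine continuous_pi fun a => continuous_pi fun b => ?_
      refine Continuous.div ?_ ?_ fun v => hs v.1 v.2
      · exact Continuous.mul (hk a) (Complex.continuous_conj.comp (hk b))
      · exact continuous_finsetSum _ fun k _ =>
          Continuous.mul (hk k) (Complex.continuous_conj.comp (hk k))
    exact this.congr fun v => (hmk v.1 v.2).symm
  refine T2Space.of_injective_continuous (f := ρ) ?_ hc
  intro x y
  induction x using Projectivization.ind with | h v hv => ?_
  induction y using Projectivization.ind with | h w hw => ?_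
  rw [hmk, hmk]
  intro h
  rw [Projectivization.mk_eq_mk_iff']
  obtain ⟨b, hb⟩ := Function.ne_iff.1 hv
  have hb' : (starRingEnd ℂ) (v b) ≠ 0 := by simpa using hb
  have h1 := hs v hv
  have h2 := hs w hw
  refine ⟨(starRingEnd ℂ) (w b) / (∑ k, w k * (starRingEnd ℂ) (w k)) *
    (∑ k, v k * (starRingEnd ℂ) (v k)) / (starRingEnd ℂ) (v b), ?_⟩
  ext a
  have := congrFun (congrFun h a) b
  simp only [Pi.smul_apply, smul_eq_mul]
  rw [div_eq_div_iff h1 h2] at this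
  field_simp
  linear_combination -this

end Proj

/-- A pencil of plane cubics spanned by two cubic forms `f`, `g` which intersect transversely
(hence in nine distinct points). -/
structure CubicPencil where
  f : MvPolynomial (Fin 3) ℂ
  g : MvPolynomial (Fin 3) ℂ
  isHomogeneous_f : f.IsHomogeneous 3
  isHomogeneous_g : g.IsHomogeneous 3
  transverse : ∀ v : Fin 3 → ℂ, v ≠ 0 → f.eval v = 0 → g.eval v = 0 →
    LinearIndependent ℂ ![fderiv ℂ (fun x => f.eval x) v, fderiv ℂ (fun x => g.eval x) v]

theorem eval_smul_of_isHomogeneous {f : MvPolynomial (Fin 3) ℂ} (hf : f.IsHomogeneous 3) (t : ℂ)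
    (v : Fin 3 → ℂ) : f.eval (t • v) = t ^ 3 * f.eval v := by
  rw [MvPolynomial.eval_eq, MvPolynomial.eval_eq, Finset.mul_sum]
  refine Finset.sum_congr rfl fun d hd => ?_
  have h := hf (MvPolynomial.mem_support_iff.1 hd)
  have e : Finsupp.degree d = Finsupp.weight 1 d :=
    DFunLike.congr_fun (Finsupp.degree_eq_weight_one (R := ℕ)) d
  rw [← e, Finsupp.degree_apply] at h
  simp only [Pi.smul_apply, smul_eq_mul, mul_pow, Finset.prod_mul_distrib]
  rw [Finset.prod_pow_eq_pow_sum, h]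
  ring

namespace CubicPencil

variable (P : CubicPencil)

/-- The bihomogeneous form `w₀ f(v) + w₁ g(v)`. -/
def form (p : (Fin 3 → ℂ) × (Fin 2 → ℂ)) : ℂ := p.2 0 * P.f.eval p.1 + p.2 1 * P.g.eval p.1

theorem form_smul (s t : ℂ) (p : (Fin 3 → ℂ) × (Fin 2 → ℂ)) :
    P.form (s • p.1, t • p.2) = s ^ 3 * t * P.form p := by
  simp only [form, eval_smul_of_isHomogeneous P.isHomogeneous_f,
    eval_smul_of_isHomogeneous P.isHomogeneous_g, Pi.smul_apply, smul_eq_mul]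
  ring

/-- The rational elliptic surface `{([v], [w]) | w₀ f(v) + w₁ g(v) = 0} ⊂ ℙ² × ℙ¹`, that is, the
blow-up of `ℙ²` in the nine base points of the pencil. -/
def Surface : Type :=
  {x : Projectivization ℂ (Fin 3 → ℂ) × Projectivization ℂ (Fin 2 → ℂ) //
    P.form (x.1.rep, x.2.rep) = 0}

instance : TopologicalSpace P.Surface := inferInstanceAs (TopologicalSpace (Subtype _))

instance : T2Space P.Surface := inferInstanceAs (T2Space (Subtype _))

/-- The elliptic fibration over `ℙ¹`. -/
def fibration (x : P.Surface) : Projectivization ℂ (Fin 2 → ℂ) := x.1.2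

/-- The pair of vectors `p = (v, w)` represents the point `([v], [w])`. -/
def Represents (p : (Fin 3 → ℂ) × (Fin 2 → ℂ)) (x : P.Surface) : Prop :=
  ∃ (h₁ : p.1 ≠ 0) (h₂ : p.2 ≠ 0),
    x.1 = (Projectivization.mk ℂ p.1 h₁, Projectivization.mk ℂ p.2 h₂)

theorem represents_form {p : (Fin 3 → ℂ) × (Fin 2 → ℂ)} {x : P.Surface} (h : P.Represents p x) :
    P.form p = 0 := by
  obtain ⟨h₁, h₂, hx⟩ := h
  have h0 := x.2
  obtain ⟨a, ha⟩ := Projectivization.exists_smul_eq_mk_rep ℂ p.1 h₁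
  obtain ⟨b, hb⟩ := Projectivization.exists_smul_eq_mk_rep ℂ p.2 h₂
  rw [hx] at h0
  simp only [← ha, ← hb, Units.smul_def] at h0
  rw [form_smul] at h0
  simpa using h0

theorem exists_represents {p : (Fin 3 → ℂ) × (Fin 2 → ℂ)} (h₁ : p.1 ≠ 0) (h₂ : p.2 ≠ 0)
    (h : P.form p = 0) : ∃ x, P.Represents p x := by
  refine ⟨⟨(Projectivization.mk ℂ p.1 h₁, Projectivization.mk ℂ p.2 h₂), ?_⟩, h₁, h₂, rfl⟩
  obtain ⟨a, ha⟩ := Projectivization.exists_smul_eq_mk_rep ℂ p.1 h₁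
  obtain ⟨b, hb⟩ := Projectivization.exists_smul_eq_mk_rep ℂ p.2 h₂
  simp only [← ha, ← hb, Units.smul_def]
  rw [form_smul, h, mul_zero]

theorem represents_unique {p : (Fin 3 → ℂ) × (Fin 2 → ℂ)} {x y : P.Surface}
    (hx : P.Represents p x) (hy : P.Represents p y) : x = y := by
  obtain ⟨_, _, hx⟩ := hx
  obtain ⟨_, _, hy⟩ := hy
  exact Subtype.ext (hx.trans hy.symm)

/-- A holomorphic chart of the surface, as a submanifold of `ℙ² × ℙ¹`: the inverse of the chart has
local holomorphic lifts to `ℂ³ × ℂ²`, and the chart is locally the restriction of a holomorphic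
function on `ℂ³ × ℂ²`. -/
def IsHolChart (c : OpenPartialHomeomorph P.Surface (ℂ × ℂ)) : Prop :=
  (∀ y ∈ c.target, ∃ V : ℂ × ℂ → (Fin 3 → ℂ) × (Fin 2 → ℂ), ContDiffAt ℂ ω V y ∧
    ∀ᶠ y' in 𝓝 y, P.Represents (V y') (c.symm y')) ∧
  (∀ x ∈ c.source, ∀ p, P.Represents p x → ∃ g : (Fin 3 → ℂ) × (Fin 2 → ℂ) → ℂ × ℂ,
    ContDiffAt ℂ ω g p ∧ ∀ᶠ p' in 𝓝 p, ∀ x', P.Represents p' x' → c x' = g p')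

theorem IsHolChart.compat {c d : OpenPartialHomeomorph P.Surface (ℂ × ℂ)} (hc : P.IsHolChart c)
    (hd : P.IsHolChart d) : ContDiffOn ℝ ∞ (c.symm.trans d) (c.symm.trans d).source := by
  intro y hy
  obtain ⟨V, hV, hV'⟩ := hc.1 y hy.1
  obtain ⟨g, hg, hg'⟩ := hd.2 (c.symm y) hy.2 (V y) hV'.self_of_nhds
  have h : ContDiffAt ℂ ω (g ∘ V) y := hg.comp y hV
  have h2 : (c.symm.trans d : ℂ × ℂ → ℂ × ℂ) =ᶠ[𝓝 y] g ∘ V := by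
    filter_upwards [hV', hV.continuousAt.eventually hg'] with y' h1 h2
    exact h2 _ h1
  exact ((h.restrict_scalars ℝ).of_le le_top |>.congr_of_eventuallyEq h2).contDiffWithinAt

theorem contDiff_form : ContDiff ℂ ω P.form := by
  have h : ∀ f : MvPolynomial (Fin 3) ℂ, ContDiff ℂ ω
      (fun p : (Fin 3 → ℂ) × (Fin 2 → ℂ) => f.eval p.1) := by
    intro f
    induction f using MvPolynomial.induction_on with
    | C a => simpa using contDiff_const
    | add f g hf hg => simpa using hf.add hg
    | mul_X f i hf =>
      simp only [map_mul, MvPolynomial.eval_X]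
      exact hf.mul (by fun_prop)
  unfold form
  exact (ContDiff.mul (by fun_prop) (h _)).add (ContDiff.mul (by fun_prop) (h _))

theorem differentiable_eval (f : MvPolynomial (Fin 3) ℂ) :
    Differentiable ℂ (fun v : Fin 3 → ℂ => f.eval v) := by
  induction f using MvPolynomial.induction_on with
  | C a => simp
  | add f g hf hg =>
    simp only [map_add]
    exact hf.add hg
  | mul_X f i hf =>
    simp only [map_mul, MvPolynomial.eval_X]
    exact hf.mul (by fun_prop)

theorem fderiv_form (p u : (Fin 3 → ℂ) × (Fin 2 → ℂ)) : fderiv ℂ P.form p u =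
    u.2 0 * P.f.eval p.1 + p.2 0 * fderiv ℂ (fun x => P.f.eval x) p.1 u.1 +
    (u.2 1 * P.g.eval p.1 + p.2 1 * fderiv ℂ (fun x => P.g.eval x) p.1 u.1) := by
  have hf := (differentiable_eval P.f p.1).hasFDerivAt.comp p
    (hasFDerivAt_fst (𝕜 := ℂ) (E := Fin 3 → ℂ) (F := Fin 2 → ℂ))
  have hg := (differentiable_eval P.g p.1).hasFDerivAt.comp p
    (hasFDerivAt_fst (𝕜 := ℂ) (E := Fin 3 → ℂ) (F := Fin 2 → ℂ))
  have h2 : ∀ k, HasFDerivAt (fun p : (Fin 3 → ℂ) × (Fin 2 → ℂ) => p.2 k)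
      ((ContinuousLinearMap.proj k).comp (ContinuousLinearMap.snd ℂ (Fin 3 → ℂ) (Fin 2 → ℂ))) p :=
    fun k => ((ContinuousLinearMap.proj k).comp
      (ContinuousLinearMap.snd ℂ (Fin 3 → ℂ) (Fin 2 → ℂ))).hasFDerivAt
  have h := ((h2 0).mul hf).add ((h2 1).mul hg)
  have h' : HasFDerivAt P.form _ p := h
  rw [h'.fderiv]
  simp [mul_comm]
  ring

/-- The surface is nonsingular. -/
theorem exists_fderiv_form_ne {p : (Fin 3 → ℂ) × (Fin 2 → ℂ)} (h₁ : p.1 ≠ 0) (h₂ : p.2 ≠ 0) :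
    ∃ u, fderiv ℂ P.form p u ≠ 0 := by
  by_contra! h
  have hf : P.f.eval p.1 = 0 := by
    have := h (0, ![1, 0])
    rw [fderiv_form] at this
    simpa using this
  have hg : P.g.eval p.1 = 0 := by
    have := h (0, ![0, 1])
    rw [fderiv_form] at this
    simpa using this
  have hli := P.transverse p.1 h₁ hf hg
  rw [LinearIndependent.pair_iff] at hli
  have := hli (p.2 0) (p.2 1) (by
    ext1 v
    have := h (v, 0)
    rw [fderiv_form] at this
    simpa using this)
  apply h₂
  ext k
  fin_cases k
  · exact this.1
  · exact this.2

theorem fderiv_form_euler (p : (Fin 3 → ℂ) × (Fin 2 → ℂ)) (h : P.form p = 0) (s t : ℂ) :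
    fderiv ℂ P.form p (s • p.1, t • p.2) = 0 := by
  have h1 : HasDerivAt (fun r : ℂ => p + r • (s • p.1, t • p.2)) (s • p.1, t • p.2) 0 := by
    simpa using ((hasDerivAt_id (0 : ℂ)).smul_const (s • p.1, t • p.2)).const_add p
  have h2 : HasFDerivAt P.form (fderiv ℂ P.form p) (p + (0 : ℂ) • (s • p.1, t • p.2)) := by
    simpa using (P.contDiff_form.differentiable (by simp) p).hasFDerivAt
  have h3 := h2.comp_hasDerivAt (0 : ℂ) h1
  have h4 : (P.form ∘ fun r : ℂ => p + r • (s • p.1, t • p.2)) = fun _ => 0 := by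
    ext r
    have e : p + r • (s • p.1, t • p.2) = ((1 + r * s) • p.1, (1 + r * t) • p.2) := by
      ext <;> simp <;> ring
    simp only [Function.comp, e, form_smul, h, mul_zero]
  rw [h4] at h3
  exact h3.unique (hasDerivAt_const _ _)

/-- Local coordinates of `ℂ³ × ℂ²` at a point of the cone over the surface. -/
theorem exists_coordinates (p : (Fin 3 → ℂ) × (Fin 2 → ℂ)) (hp : P.form p = 0) (i : Fin 3)
    (j : Fin 2) (hi : p.1 i = 1) (hj : p.2 j = 1) :
    ∃ (l : ((Fin 3 → ℂ) × (Fin 2 → ℂ)) →L[ℂ] ℂ × ℂ)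
      (G : OpenPartialHomeomorph ((Fin 3 → ℂ) × (Fin 2 → ℂ)) ((ℂ × ℂ × ℂ) × (ℂ × ℂ))),
      p ∈ G.source ∧ (∀ x, G x = ((P.form x, x.1 i, x.2 j), l x)) ∧
      ∀ y ∈ G.target, ContDiffAt ℂ ω G.symm y := by
  have h₁ : p.1 ≠ 0 := fun h => by simp [h] at hi
  have h₂ : p.2 ≠ 0 := fun h => by simp [h] at hj
  obtain ⟨u, hu⟩ := P.exists_fderiv_form_ne h₁ h₂
  let A : ((Fin 3 → ℂ) × (Fin 2 → ℂ)) →L[ℂ] ℂ :=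
    (ContinuousLinearMap.proj i).comp (ContinuousLinearMap.fst ℂ (Fin 3 → ℂ) (Fin 2 → ℂ))
  let B : ((Fin 3 → ℂ) × (Fin 2 → ℂ)) →L[ℂ] ℂ :=
    (ContinuousLinearMap.proj j).comp (ContinuousLinearMap.snd ℂ (Fin 3 → ℂ) (Fin 2 → ℂ))
  let L : ((Fin 3 → ℂ) × (Fin 2 → ℂ)) →L[ℂ] ℂ × ℂ × ℂ := (fderiv ℂ P.form p).prod (A.prod B)
  have hL : Function.Surjective L := by
    rintro ⟨a, b, c⟩
    set t := a / fderiv ℂ P.form p u with ht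
    refine ⟨t • u + ((b - t * u.1 i) • p.1, (c - t * u.2 j) • p.2), ?_⟩
    refine Prod.ext ?_ (Prod.ext ?_ ?_)
    · change fderiv ℂ P.form p _ = a
      rw [map_add, P.fderiv_form_euler p hp, map_smul, ht, smul_eq_mul, add_zero,
        div_mul_cancel₀ _ hu]
    · simp [L, A, hi]
    · simp [L, B, hj]
  obtain ⟨π, hπ⟩ := LinearMap.exists_leftInverse_of_injective L.toLinearMap.ker.subtype
    (Submodule.ker_subtype _)
  have hdim : Module.finrank ℂ L.toLinearMap.ker = Module.finrank ℂ (ℂ × ℂ) := by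
    have h := LinearMap.finrank_range_add_finrank_ker L.toLinearMap
    rw [LinearMap.range_eq_top.2 hL] at h
    simp at h ⊢
    omega
  let ψ := LinearEquiv.ofFinrankEq _ _ hdim
  let l : ((Fin 3 → ℂ) × (Fin 2 → ℂ)) →L[ℂ] ℂ × ℂ :=
    (ψ.toLinearMap.comp π).toContinuousLinearMap
  let T : ((Fin 3 → ℂ) × (Fin 2 → ℂ)) →L[ℂ] (ℂ × ℂ × ℂ) × (ℂ × ℂ) := L.prod l
  have hT : Function.Injective T.toLinearMap := by
    rw [← LinearMap.ker_eq_bot, LinearMap.ker_eq_bot']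
    intro x hx
    have hx1 : L x = 0 := congrArg Prod.fst hx
    have hx2 : ψ (π x) = 0 := congrArg Prod.snd hx
    have hx3 : π x = 0 := by simpa using hx2
    have h := LinearMap.congr_fun hπ ⟨x, hx1⟩
    change π x = ⟨x, hx1⟩ at h
    rw [hx3] at h
    exact (congrArg Subtype.val h).symm
  let e := (LinearMap.linearEquivOfInjective T.toLinearMap hT
    (by simp)).toContinuousLinearEquiv
  have he : (e : _ →L[ℂ] _) = T := by
    refine ContinuousLinearMap.ext fun x => ?_
    rfl
  let G₀ : (Fin 3 → ℂ) × (Fin 2 → ℂ) → (ℂ × ℂ × ℂ) × (ℂ × ℂ) :=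
    fun x => ((P.form x, x.1 i, x.2 j), l x)
  have hG₀ : ContDiffAt ℂ ω G₀ p :=
    ((P.contDiff_form.prodMk ((A.contDiff).prodMk B.contDiff)).prodMk l.contDiff).contDiffAt
  have hG₀' : HasFDerivAt G₀ (e : _ →L[ℂ] _) p := by
    rw [he]
    exact ((P.contDiff_form.differentiable (by simp) p).hasFDerivAt.prodMk
      (A.hasFDerivAt.prodMk B.hasFDerivAt)).prodMk l.hasFDerivAt
  let G₁ := hG₀.toOpenPartialHomeomorph G₀ hG₀' (by simp)
  have hmem : p ∈ G₁.source := hG₀.mem_toOpenPartialHomeomorph_source hG₀' (by simp)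
  have hinv : ContDiffAt ℂ ω G₁.symm (G₀ p) := hG₀.to_localInverse hG₀' (by simp)
  obtain ⟨Ω, hΩ, hΩo, hΩp⟩ := _root_.eventually_nhds_iff.1 (hinv.eventually (by simp))
  refine ⟨l, (G₁.symm.restrOpen Ω hΩo).symm, ?_, fun x => rfl, ?_⟩
  · exact ⟨hmem, hΩp⟩
  · intro y hy
    exact hΩ y hy.2

/-- The normalized representative of a point. -/
def normalized (i : Fin 3) (j : Fin 2) (x : P.Surface) : (Fin 3 → ℂ) × (Fin 2 → ℂ) :=
  (ratio i x.1.1, ratio j x.1.2)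

/-- The points with nonvanishing `i`-th and `j`-th coordinate. -/
def patch (i : Fin 3) (j : Fin 2) : Set P.Surface := {x | x.1.1.rep i ≠ 0 ∧ x.1.2.rep j ≠ 0}

theorem isOpen_patch (i : Fin 3) (j : Fin 2) : IsOpen (P.patch i j) :=
  ((isOpen_rep_ne i).preimage (continuous_fst.comp continuous_subtype_val)).inter
    ((isOpen_rep_ne j).preimage (continuous_snd.comp continuous_subtype_val))

theorem continuousOn_normalized (i : Fin 3) (j : Fin 2) :
    ContinuousOn (P.normalized i j) (P.patch i j) :=
  ((continuousOn_ratio i).comp (continuous_fst.comp continuous_subtype_val).continuousOn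
    fun _ hx => hx.1).prodMk
  ((continuousOn_ratio j).comp (continuous_snd.comp continuous_subtype_val).continuousOn
    fun _ hx => hx.2)

theorem normalized_eq {i : Fin 3} {j : Fin 2} {p : (Fin 3 → ℂ) × (Fin 2 → ℂ)} {x : P.Surface}
    (h : P.Represents p x) :
    P.normalized i j x = ((p.1 i)⁻¹ • p.1, (p.2 j)⁻¹ • p.2) := by
  obtain ⟨h₁, h₂, hx⟩ := h
  rw [normalized, hx, ratio_mk, ratio_mk]

theorem mem_patch_iff {i : Fin 3} {j : Fin 2} {p : (Fin 3 → ℂ) × (Fin 2 → ℂ)} {x : P.Surface}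
    (h : P.Represents p x) : x ∈ P.patch i j ↔ p.1 i ≠ 0 ∧ p.2 j ≠ 0 := by
  obtain ⟨h₁, h₂, hx⟩ := h
  change _ ∧ _ ↔ _
  rw [hx, rep_mk_ne, rep_mk_ne]

theorem represents_rep (x : P.Surface) : P.Represents (x.1.1.rep, x.1.2.rep) x :=
  ⟨x.1.1.rep_nonzero, x.1.2.rep_nonzero, by
    simp only [Projectivization.mk_rep]⟩

theorem Represents.smul {p : (Fin 3 → ℂ) × (Fin 2 → ℂ)} {x : P.Surface} (h : P.Represents p x)
    {s t : ℂ} (hs : s ≠ 0) (ht : t ≠ 0) : P.Represents (s • p.1, t • p.2) x := by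
  obtain ⟨h₁, h₂, hx⟩ := h
  refine ⟨smul_ne_zero hs h₁, smul_ne_zero ht h₂, ?_⟩
  rw [hx]
  refine Prod.ext ?_ ?_
  · exact ((Projectivization.mk_eq_mk_iff' ℂ _ _ _ _).2 ⟨s, rfl⟩).symm
  · exact ((Projectivization.mk_eq_mk_iff' ℂ _ _ _ _).2 ⟨t, rfl⟩).symm

theorem represents_normalized {i : Fin 3} {j : Fin 2} {x : P.Surface} (hx : x ∈ P.patch i j) :
    P.Represents (P.normalized i j x) x :=
  Represents.smul P (P.represents_rep x) (inv_ne_zero hx.1) (inv_ne_zero hx.2)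

theorem normalized_apply {i : Fin 3} {j : Fin 2} {x : P.Surface} (hx : x ∈ P.patch i j) :
    (P.normalized i j x).1 i = 1 ∧ (P.normalized i j x).2 j = 1 :=
  ⟨inv_mul_cancel₀ hx.1, inv_mul_cancel₀ hx.2⟩

open Classical in
/-- The point represented by a pair of vectors (with a default value). -/
def toPoint (x₀ : P.Surface) (p : (Fin 3 → ℂ) × (Fin 2 → ℂ)) : P.Surface :=
  if h : ∃ x, P.Represents p x then h.choose else x₀

theorem toPoint_eq (x₀ : P.Surface) {p : (Fin 3 → ℂ) × (Fin 2 → ℂ)} {x : P.Surface}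
    (h : P.Represents p x) : P.toPoint x₀ p = x := by
  have h' : ∃ x, P.Represents p x := ⟨x, h⟩
  rw [toPoint, dif_pos h']
  exact P.represents_unique h'.choose_spec h

theorem continuousOn_toPoint (x₀ : P.Surface) :
    ContinuousOn (P.toPoint x₀) {p | ∃ x, P.Represents p x} := by
  rw [continuousOn_iff_continuous_domRestrict]
  have h : ∀ n : ℕ, Continuous (Projectivization.mk' ℂ (V := Fin n → ℂ)) := fun n =>
    isQuotientMap_mk'.continuous
  have h1 : Continuous (fun p : {p | ∃ x, P.Represents p x} =>
      ((Projectivization.mk' ℂ ⟨p.1.1, p.2.choose_spec.1⟩, Projectivization.mk' ℂ ⟨p.1.2,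
        p.2.choose_spec.2.1⟩) : Projectivization ℂ (Fin 3 → ℂ) × Projectivization ℂ (Fin 2 → ℂ))) :=
    ((h 3).comp ((continuous_fst.comp continuous_subtype_val).subtype_mk _)).prodMk
      ((h 2).comp ((continuous_snd.comp continuous_subtype_val).subtype_mk _))
  refine continuous_induced_rng.2 (h1.congr fun p => ?_)
  obtain ⟨x, hx⟩ := p.2
  change _ = (P.toPoint x₀ p.1).1
  rw [P.toPoint_eq x₀ hx]
  obtain ⟨_, _, hx⟩ := hx
  exact hx.symm

theorem exists_isHolChart (x₀ : P.Surface) : ∃ c, P.IsHolChart c ∧ x₀ ∈ c.source := by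
  obtain ⟨i, hi⟩ := Function.ne_iff.1 x₀.1.1.rep_nonzero
  obtain ⟨j, hj⟩ := Function.ne_iff.1 x₀.1.2.rep_nonzero
  have hx₀ : x₀ ∈ P.patch i j := ⟨hi, hj⟩
  obtain ⟨l, G, hpG, hG, hGs⟩ := P.exists_coordinates (P.normalized i j x₀)
    (P.represents_form (P.represents_normalized hx₀)) i j (P.normalized_apply hx₀).1
    (P.normalized_apply hx₀).2
  have hGN : ∀ x ∈ P.patch i j, G (P.normalized i j x) = ((0, 1, 1), l (P.normalized i j x)) := by
    intro x hx
    rw [hG, P.represents_form (P.represents_normalized hx), (P.normalized_apply hx).1,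
      (P.normalized_apply hx).2]
  have hinv : ∀ y : ℂ × ℂ, ((0, 1, 1), y) ∈ G.target →
      ∃ x ∈ P.patch i j, P.Represents (G.symm ((0, 1, 1), y)) x ∧
        P.normalized i j x = G.symm ((0, 1, 1), y) ∧ l (P.normalized i j x) = y := by
    intro y hy
    set p := G.symm ((0, 1, 1), y) with hp
    have h := G.right_inv hy
    rw [← hp, hG] at h
    have e1 : P.form p = 0 := congrArg (fun q => q.1.1) h
    have e2 : p.1 i = 1 := congrArg (fun q => q.1.2.1) h
    have e3 : p.2 j = 1 := congrArg (fun q => q.1.2.2) h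
    have e4 : l p = y := congrArg (fun q => q.2) h
    obtain ⟨x, hx⟩ := P.exists_represents (fun h => by simp [h] at e2)
      (fun h => by simp [h] at e3) e1
    have hN : P.normalized i j x = p := by
      rw [P.normalized_eq hx, e2, e3]
      simp
    exact ⟨x, (P.mem_patch_iff hx).2 ⟨by simp [e2], by simp [e3]⟩, hx, hN, by rw [hN, e4]⟩
  let c : OpenPartialHomeomorph P.Surface (ℂ × ℂ) :=
    { toFun := fun x => l (P.normalized i j x)
      invFun := fun y => P.toPoint x₀ (G.symm ((0, 1, 1), y))
      source := P.patch i j ∩ P.normalized i j ⁻¹' G.source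
      target := {y | ((0, 1, 1), y) ∈ G.target}
      map_source' := by
        intro x hx
        rw [mem_ofPred_eq, ← hGN x hx.1]
        exact G.map_source hx.2
      map_target' := by
        intro y hy
        obtain ⟨x, hx, hx2, hx3, hx4⟩ := hinv y hy
        rw [P.toPoint_eq x₀ hx2]
        refine ⟨hx, ?_⟩
        rw [mem_preimage, hx3]
        exact G.map_target hy
      left_inv' := by
        intro x hx
        rw [← hGN x hx.1, G.left_inv hx.2]
        exact P.toPoint_eq x₀ (P.represents_normalized hx.1)
      right_inv' := by
        intro y hy
        obtain ⟨x, hx, hx2, hx3, hx4⟩ := hinv y hy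
        rw [P.toPoint_eq x₀ hx2, hx4]
      open_source := (P.continuousOn_normalized i j).isOpen_inter_preimage (P.isOpen_patch i j)
        G.open_source
      open_target := G.open_target.preimage (by fun_prop)
      continuousOn_toFun := l.continuous.comp_continuousOn
        ((P.continuousOn_normalized i j).mono inter_subset_left)
      continuousOn_invFun := by
        refine (P.continuousOn_toPoint x₀).comp
          (G.continuousOn_symm.comp (by fun_prop) fun y hy => hy) fun y hy => ?_
        obtain ⟨x, hx, hx2, -⟩ := hinv y hy
        exact ⟨x, hx2⟩ }
  refine ⟨c, ⟨?_, ?_⟩, hx₀, hpG⟩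
  · intro y hy
    refine ⟨fun y => G.symm ((0, 1, 1), y), ?_, ?_⟩
    · exact (hGs _ hy).comp y (contDiffAt_const.prodMk contDiffAt_id)
    · filter_upwards [c.open_target.mem_nhds hy] with y' hy'
      obtain ⟨x, hx, hx2, -⟩ := hinv y' hy'
      change P.Represents _ (P.toPoint x₀ _)
      rw [P.toPoint_eq x₀ hx2]
      exact hx2
  · intro x hx p hp
    obtain ⟨h1, h2⟩ := (P.mem_patch_iff hp).1 hx.1
    refine ⟨fun p => l ((p.1 i)⁻¹ • p.1, (p.2 j)⁻¹ • p.2), ?_, ?_⟩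
    · refine l.contDiff.contDiffAt.comp p (ContDiffAt.prodMk ?_ ?_)
      · exact ContDiffAt.fun_smul (ContDiffAt.fun_inv (by fun_prop) h1) contDiffAt_fst
      · exact ContDiffAt.fun_smul (ContDiffAt.fun_inv (by fun_prop) h2) contDiffAt_snd
    · filter_upwards with p' x' hx'
      change l (P.normalized i j x') = _
      rw [P.normalized_eq hx']

/-- A real-linear identification of `ℂ²` with the model space `ℝ¹ × ℝ³`. -/
def modelEquiv : (ℂ × ℂ) ≃L[ℝ] EuclideanSpace ℝ (Fin 1) × EuclideanSpace ℝ (Fin 3) :=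
  ContinuousLinearEquiv.ofFinrankEq (by simp)

/-- `modelEquiv` as a homeomorphism onto the model space. -/
def modelHomeo : (ℂ × ℂ) ≃ₜ H4 := modelEquiv.toHomeomorph

instance : ChartedSpace H4 P.Surface where
  atlas := {e | ∃ c, P.IsHolChart c ∧ e = c.trans modelHomeo.toOpenPartialHomeomorph}
  chartAt x := (P.exists_isHolChart x).choose.trans modelHomeo.toOpenPartialHomeomorph
  mem_chart_source x := by simpa using (P.exists_isHolChart x).choose_spec.2
  chart_mem_atlas x := ⟨_, (P.exists_isHolChart x).choose_spec.1, rfl⟩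

instance : IsManifold I4 ∞ P.Surface := by
  apply isManifold_of_contDiffOn
  rintro _ _ ⟨c, hc, rfl⟩ ⟨d, hd, rfl⟩
  have h := hc.compat P hd
  have h2 := modelEquiv.contDiff (n := ∞).comp_contDiffOn
    (h.comp modelEquiv.symm.contDiff.contDiffOn (s := modelEquiv.symm ⁻¹'
      (c.symm.trans d).source) fun x hx => hx)
  have e : ∀ x, (I4.symm x : H4) = x := fun x => rfl
  refine (h2.mono ?_).congr ?_
  · intro x hx
    have h3 := hx.1
    rw [mem_preimage] at h3
    have h4 := h3.1
    have h5 := h3.2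
    exact ⟨h4.2, h5.1⟩
  · intro x hx
    rfl

/-- The elliptic surface `E(1)` as a smooth 4-manifold. -/
def E1 : Mfd4 where
  carrier := P.Surface

end CubicPencil

/-- A tubular neighbourhood `ν` of a regular fiber of the elliptic fibration, together with an
orientation preserving trivialization compatible with the fibration: `ν (T² × z)` is the fiber over
a point `[c z]` depending holomorphically on `z`, and `ν` preserves orientations, for the
orientation of the surface given by its complex structure. -/
def CubicPencil.IsFiberNhd (P : CubicPencil) (ν : TorusNhd P.E1) : Prop :=
  (∃ c : ℂ → Fin 2 → ℂ, DifferentiableOn ℂ c (ball 0 1) ∧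
    ∀ z ∈ ball (0 : ℂ) 1, ∃ hz : c z ≠ 0, ∀ x : P.Surface,
      P.fibration x = Projectivization.mk ℂ (c z) hz ↔ ∃ u s : Circle, ν.map (u, s, z) = x) ∧
  ∀ φ : OpenPartialHomeomorph P.Surface (ℂ × ℂ), P.IsHolChart φ →
    ∀ x : ℝ × ℝ × ℂ, x.2.2 ∈ ball (0 : ℂ) 1 →
      ν.map (Circle.exp x.1, Circle.exp x.2.1, x.2.2) ∈ φ.source →
      0 < (Matrix.of fun k : Fin 4 => (fun v : ℂ × ℂ => KnotTube.realCoord v.1 v.2)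
        (fderiv ℝ (fun y : ℝ × ℝ × ℂ => φ (ν.map (Circle.exp y.1, Circle.exp y.2.1, y.2.2))) x
          (![(1, 0, 0), (0, 1, 0), (0, 0, 1), (0, 0, Complex.I)] k))).det

/-- The choices in the construction of the surfaces `E(n)`: an elliptic surface `E(1)`, and tubular
neighbourhoods of two regular fibers `F`, `F'` with trivializations, disjoint from each other. -/
structure EllipticData where
  pencil : CubicPencil
  fiber : TorusNhd pencil.E1
  fiber' : TorusNhd pencil.E1
  isFiberNhd : pencil.IsFiberNhd fiber
  isFiberNhd' : pencil.IsFiberNhd fiber'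
  disjoint : Disjoint fiber.map.target fiber'.map.target

/-- The elliptic surface `E(k + 1)` with a regular fiber `F`: it is equal to `E(1)` for `k = 0`, and
to the fiber sum of `E(1)` and `E(k)` along the fiber `F'` of `E(1)` and the fiber `F` of `E(k)` for
`k ≥ 1`, with the fiber `F` of the first summand `E(1)`. -/
def ellipticSucc (D : EllipticData) : ℕ → FramedMfd
  | 0 => ⟨D.pencil.E1, D.fiber⟩
  | k + 1 => ⟨fiberSum ⟨D.pencil.E1, D.fiber'⟩ (ellipticSucc D k),
      D.fiber.inFiberSum D.fiber' (ellipticSucc D k) D.disjoint⟩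

/-- The elliptic surface `E(n)`, `n ≥ 1`, with a tubular neighbourhood of a regular fiber `F`. -/
def elliptic (D : EllipticData) (n : ℕ) : FramedMfd := ellipticSucc D (n - 1)

/-- The tubular neighbourhoods of the link `L_{p,q} = A ∪ B̂_{p,q}`. -/
def braidLink (B : KnotTube) : Fin 2 → KnotTube := ![axis, B]

theorem braidLink_disjoint {B : KnotTube} (hB : Disjoint axis.map.target B.map.target)
    (i k : Fin 2) (h : i ≠ k) :
    Disjoint (braidLink B i).map.target (braidLink B k).map.target := by
  fin_cases i <;> fin_cases k
  · exact (h rfl).elim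
  · exact hB
  · exact hB.symm
  · exact (h rfl).elim

/-- The homology basis `(α, β) = (μ, λ)`. -/
def basisMuLambda : Matrix.SpecialLinearGroup (Fin 2) ℤ := 1

/-- The homology basis `(α, β) = (λ, -μ)`. -/
def basisLambdaNegMu : Matrix.SpecialLinearGroup (Fin 2) ℤ :=
  ⟨!![0, 1; -1, 0], by simp⟩

end LinkSurgery

end

/-! The reason is that gluing `S¹ × (S³ ∖ ν(A))` to `E(n) ∖ ν(F)` with the basis `(μ(A), λ(A))` just
gives `E(n)` back. The exterior of the unknot is a solid torus whose core is a meridian of `A` and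
whose meridian is a longitude of `A`, so `S¹ × (S³ ∖ ν(A))` is a copy of `T² × D²` and fills the
hole exactly as `ν(F)` did. Under this identification `S¹ × K` becomes the torus `T` in `ν(F)` along
which the fiber sum is formed. It remains to see that the gluing of `E(r) ∖ ν(F)` with the basis
`(λ, -μ)` of `K` is the fiber sum gluing along `T`.

Both statements become exact identities in collar coordinates `(u, s, z)`, with no isotopy needed.
`torusExterior_axis_ofBasis` says that the collar map with basis `(μ, λ)` followed by the
identification of the exterior of the axis with `T² × ℂ` is the identity. `conj_std_eq_ofBasis` says
that the standard collar map followed by conjugation on the normal disc, which is built into the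
framing of `T`, is the collar map with basis `(λ, -μ)`.

Everything takes place in `ν(F)` and in the collars, so the comparison is made for arbitrary framed
4-manifolds `X`, `Y` and a knot tube `K` disjoint from that of the axis. The three pieces of the
link surgery, namely `X ∖ ν(F)`, `Y ∖ ν(F)` and `S¹ × (S³ ∖ ν(A ∪ K))`, are embedded in the fiber
sum by `satelliteChart`. They cover it, and two points coincide there exactly when they are glued in
the link surgery. By `nonempty_diffeomorph_of_charts` the two manifolds are then diffeomorphic. A
geometric point behind this is `satellite_map_mem_tube`: the neighbourhood of `T` stays inside the
closed tube of `F`, away from the collar where `X ∖ ν(F)` is attached. -/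

namespace LinkSurgery

/-! ### Diffeomorphisms from families of charts -/

section Charts

variable {J : Type*} {P : J → Mfd4} {M N : Mfd4}

theorem exists_contMDiff_of_charts (e : ∀ j, OpenPartialHomeomorph (P j) M)
    (d : ∀ j, OpenPartialHomeomorph (P j) N) (he : ∀ j, IsDiffeo I4 I4 (e j))
    (hd : ∀ j, IsDiffeo I4 I4 (d j)) (hs : ∀ j, (e j).source = (d j).source)
    (hM : ∀ m, ∃ j, ∃ x ∈ (e j).source, e j x = m)
    (h : ∀ j k, ∀ x ∈ (e j).source, ∀ y ∈ (e k).source, e j x = e k y → d j x = d k y) :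
    ∃ f : M → N, ContMDiff I4 I4 ∞ f ∧ ∀ j, ∀ x ∈ (e j).source, f (e j x) = d j x := by
  choose j x hx hxm using hM
  have hf : ∀ k, ∀ y ∈ (e k).source, d (j (e k y)) (x (e k y)) = d k y := fun k y hy =>
    h _ _ _ (hx _) _ hy (hxm _)
  refine ⟨fun m => d (j m) (x m), fun m => ?_, hf⟩
  have hm : m ∈ (e (j m)).target := by
    have := (e (j m)).map_source (hx m)
    rwa [hxm m] at this
  -- The index chosen for a point varies without any continuity. By well-definedness, the index
  -- chosen at `m` may be kept fixed nearby, so that locally the map is the single smooth map `d j ∘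
  -- (e j)⁻¹`.
  have hdiff := ((he (j m)).symm.trans (hd (j m))).1.contMDiffAt (x := m)
    ((OpenPartialHomeomorph.open_source _).mem_nhds (by
      refine ⟨hm, ?_⟩
      rw [mem_preimage, ← hs]
      exact (e (j m)).map_target hm))
  refine hdiff.congr_of_eventuallyEq ?_
  filter_upwards [(e (j m)).open_target.mem_nhds hm] with m' hm'
  have := hf _ _ ((e (j m)).map_target hm')
  rwa [(e (j m)).right_inv hm'] at this

/-- Two manifolds covered by the images of the same manifolds, with the same identifications, are
diffeomorphic. -/
theorem nonempty_diffeomorph_of_charts (e : ∀ j, OpenPartialHomeomorph (P j) M)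
    (d : ∀ j, OpenPartialHomeomorph (P j) N) (he : ∀ j, IsDiffeo I4 I4 (e j))
    (hd : ∀ j, IsDiffeo I4 I4 (d j)) (hs : ∀ j, (e j).source = (d j).source)
    (hM : ∀ m, ∃ j, ∃ x ∈ (e j).source, e j x = m)
    (hN : ∀ n, ∃ j, ∃ x ∈ (d j).source, d j x = n)
    (h : ∀ j k, ∀ x ∈ (d j).source, ∀ y ∈ (d k).source, e j x = e k y ↔ d j x = d k y) :
    Nonempty (Diffeomorph I4 I4 M N ∞) := by
  obtain ⟨f, hf, hfe⟩ := exists_contMDiff_of_charts e d he hd hs hM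
    fun j k x hx y hy => (h j k x (hs j ▸ hx) y (hs k ▸ hy)).1
  obtain ⟨g, hg, hgd⟩ := exists_contMDiff_of_charts d e hd he (fun j => (hs j).symm) hN
    fun j k x hx y hy => (h j k x hx y hy).2
  refine ⟨⟨⟨f, g, fun m => ?_, fun n => ?_⟩, hf, hg⟩⟩
  · obtain ⟨j, x, hx, rfl⟩ := hM m
    rw [hfe j x hx, hgd j x (hs j ▸ hx)]
  · obtain ⟨j, x, hx, rfl⟩ := hN n
    rw [hgd j x hx, hfe j x (hs j ▸ hx)]

end Charts

/-! ### Coincidence of points in a glued space -/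

namespace Gluing

variable {ι : Type} (G : Gluing ι)

theorem exists_incl_eq [∀ j, Nonempty (G.dom j)] (z : G.Space) :
    ∃ j, ∃ x ∈ G.dom j, G.incl j x = z := by
  obtain ⟨⟨j, x⟩, rfl⟩ := G.surjective_proj z
  exact ⟨j, x.1, x.2, G.incl_apply j x⟩

theorem incl_some_eq_incl_none {i : ι} [Nonempty (G.dom (some i))] [Nonempty (G.dom none)]
    {x : G.piece (some i)} {c : G.piece none} (hx : x ∈ G.dom (some i)) (hc : c ∈ G.dom none) :
    G.incl (some i) x = G.incl none c ↔ x ∈ (G.glue i).source ∧ G.glue i x = c := by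
  rw [G.incl_apply (some i) ⟨x, hx⟩, G.incl_apply none ⟨c, hc⟩, proj_some_none]

theorem incl_some_ne_incl_some {i k : ι} (hik : i ≠ k) [Nonempty (G.dom (some i))]
    [Nonempty (G.dom (some k))] {x : G.piece (some i)} {y : G.piece (some k)}
    (hx : x ∈ G.dom (some i)) (hy : y ∈ G.dom (some k)) :
    G.incl (some i) x ≠ G.incl (some k) y := by
  rw [G.incl_apply (some i) ⟨x, hx⟩, G.incl_apply (some k) ⟨y, hy⟩]
  exact G.proj_some_ne hik _ _

/-- A point of a gluing region lies in the domain of one piece and its image in the domain of the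
central one. This provides the nonemptiness on which `incl` depends. -/
theorem nonempty_dom (h : ∀ i, (G.glue i).source.Nonempty) [Nonempty ι] (j : Option ι) :
    Nonempty (G.dom j) := by
  rcases j with _ | i
  · obtain ⟨i⟩ := ‹Nonempty ι›
    obtain ⟨x, hx⟩ := h i
    exact ⟨⟨_, G.target_subset i ((G.glue i).map_source hx)⟩⟩
  · obtain ⟨x, hx⟩ := h i
    exact ⟨⟨x, G.source_subset i hx⟩⟩

end Gluing

theorem mem_annulus_three_quarters : (3 / 4 : ℂ) ∈ annulus := by
  constructor <;> norm_num

theorem nonempty_collarMap_source {M N : Mfd4} (μ : TorusNhd M) (ν : TorusNhd N) (κ : Collar) :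
    (collarMap μ ν κ).source.Nonempty :=
  ⟨ν.map (1, 1, 3 / 4), (mem_collarMap_source μ ν κ).2 ⟨_, mem_annulus_three_quarters, rfl⟩⟩

/-! ### The exterior of the axis -/

/-- The transition between the two solid torus coordinates of `S³`. The point is a positive multiple
of `(l, r s)`; renormalizing the second coordinate instead of the first exchanges the two directions
and inverts the radius. -/
theorem solidInv_one_solidFun_zero (l s : Circle) {r : ℝ} (hr : 0 < r) :
    solidInv 1 (solidFun 0 (l, r • (s : ℂ))) = (s, r⁻¹ • (l : ℂ)) := by
  set c : ℝ := (√(1 + ‖r • (s : ℂ)‖ ^ 2))⁻¹ with hc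
  have hc0 : 0 < c := by positivity
  have e0 : (solidFun 0 (l, r • (s : ℂ))).1 0 = c • (l : ℂ) := by simp [solidFun, hc]
  have e1 : (solidFun 0 (l, r • (s : ℂ))).1 1 = (c * r) • (s : ℂ) := by
    simp [solidFun, hc, mul_assoc]
  refine Prod.ext ?_ ?_
  · change dir ((solidFun 0 (l, r • (s : ℂ))).1 1) = s
    rw [e1, dir_smul (by positivity)]
  · change ‖(solidFun 0 (l, r • (s : ℂ))).1 1‖⁻¹ • (solidFun 0 (l, r • (s : ℂ))).1 0 = _
    rw [e0, e1, norm_smul, Circle.norm_coe, mul_one, Real.norm_of_nonneg (by positivity),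
      smul_smul]
    congr 1
    field_simp

theorem norm_axisComplement (x : S3) : ‖(axisComplement x).2‖ = ‖x.1 1‖⁻¹ * ‖x.1 0‖ / 2 := by
  change ‖((1 / 2 : ℝ) : ℂ) * (starRingEnd ℂ) ((‖x.1 1‖⁻¹ : ℝ) • x.1 0)‖ = _
  rw [norm_mul, RCLike.norm_conj, norm_smul, norm_inv, norm_norm, Complex.norm_real]
  norm_num
  ring

/-- In the tubular neighbourhood of the axis the normal coordinate has norm `‖x 1‖ / ‖x 0‖`, and the
closed tube is where it is at most `1/2`. -/
theorem mem_axis_torus_tube (p : Circle × S3) :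
    p ∈ axis.torus.tube ↔ 2 * ‖p.2.1 1‖ ≤ ‖p.2.1 0‖ := by
  obtain ⟨u, x⟩ := p
  constructor
  · rintro ⟨⟨v, l, w⟩, ⟨-, -, hw⟩, h⟩
    rw [mem_closedBall_zero_iff] at hw
    have hx : solidFun 0 (l, w) = x := congrArg Prod.snd h
    have h0 : (0 : ℝ) < (√(1 + ‖w‖ ^ 2))⁻¹ := by positivity
    rw [← hx]
    have e0 : (solidFun 0 (l, w)).1 0 = (√(1 + ‖w‖ ^ 2))⁻¹ • (l : ℂ) := by simp [solidFun]
    have e1 : (solidFun 0 (l, w)).1 1 = (√(1 + ‖w‖ ^ 2))⁻¹ • w := by simp [solidFun]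
    change 2 * ‖(solidFun 0 (l, w)).1 1‖ ≤ ‖(solidFun 0 (l, w)).1 0‖
    rw [e0, e1, norm_smul, norm_smul, Circle.norm_coe, Real.norm_of_nonneg h0.le]
    -- As `l` has norm one, this is `2 ‖w‖ ≤ 1` multiplied by the common positive normalizing
    -- factor.
    nlinarith
  · intro h
    change 2 * ‖x.1 1‖ ≤ ‖x.1 0‖ at h
    have hn := norm_sq_S3 0 x
    rw [zero_add] at hn
    -- If `x 0` vanished, the inequality would make `x 1` vanish too, which is impossible on the
    -- sphere. Hence `solidInv 0` is a genuine inverse at `x`.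
    have h0 : 0 < ‖x.1 0‖ := by
      by_contra h1
      have h2 : ‖x.1 0‖ = 0 := le_antisymm (not_lt.1 h1) (norm_nonneg _)
      have h3 : ‖x.1 1‖ = 0 := le_antisymm (by linarith) (norm_nonneg _)
      rw [h2, h3] at hn
      norm_num at hn
    refine ⟨(u, solidInv 0 x), ⟨trivial, trivial, ?_⟩, ?_⟩
    · change ‖x.1 0‖⁻¹ • x.1 1 ∈ closedBall (0 : ℂ) (1 / 2)
      rw [mem_closedBall_zero_iff, norm_smul, norm_inv, norm_norm, inv_mul_le_iff₀ h0]
      linarith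
    · exact Prod.ext rfl ((solid 0).right_inv (norm_pos_iff.1 h0))

/-- The identification of `S¹ × (S³ ∖ A)` with `T² × ℂ`. -/
noncomputable def torusExterior : OpenPartialHomeomorph circleTimesS3 (Circle × Circle × ℂ) :=
  (OpenPartialHomeomorph.refl Circle).prod axisComplement

theorem isDiffeo_torusExterior : IsDiffeo I4 IT torusExterior :=
  isDiffeo_refl.prod isDiffeo_axisComplement

/-- No bound on the radius is built into `axisComplement`; the restriction to the unit disc comes
only from the neighbourhood with which it is composed. -/
theorem mem_torusExterior_target (q : Circle × Circle × ℂ) : q ∈ torusExterior.target := by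
  simp [torusExterior, axisComplement, solid, conjScale]

/-- With `y = 1 / (2 z)`, the collar map sends `(s, z)` to `(y / |y|, |y| s)` in the neighbourhood
of the axis. In the complementary solid torus this is `(s, y / |y|²)`, and conjugating and halving
gives `1 / (2 y) = z`. The factor `1/2` in `axisComplement` is matched to the one in `flip`, so that
radii agree as well as directions. -/
theorem torusExterior_axis_ofBasis {q : Circle × Circle × ℂ} (hq : q.2.2 ∈ annulus) :
    torusExterior (axis.torus.map ((Collar.ofBasis basisMuLambda).map q)) = q := by
  obtain ⟨u, s, z⟩ := q
  have hz : z ≠ 0 := ne_zero_of_mem_annulus hq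
  set y : ℂ := (2 * z)⁻¹ with hy
  have hy0 : y ≠ 0 := inv_ne_zero (mul_ne_zero two_ne_zero hz)
  have hyn : 0 < ‖y‖ := norm_pos_iff.2 hy0
  -- The identity matrix does not give the identity twist: its rows refer to `(μ, λ)`, whereas the
  -- first coordinate of a knot tube runs along `λ`. The twist therefore exchanges the two circles.
  have ht : (Collar.ofBasis basisMuLambda).map (u, s, z) = (u, dir y, ‖y‖ • (s : ℂ)) := by
    change (u, twistFun 1 0 0 1 (s, y)) = _
    simp [twistFun]
  rw [ht]
  refine Prod.ext rfl ?_
  change (OpenPartialHomeomorph.refl Circle).prod (conjScale (1 / 2) (by norm_num))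
    (solidInv 1 (solidFun 0 (dir y, ‖y‖ • (s : ℂ)))) = (s, z)
  rw [solidInv_one_solidFun_zero _ _ hyn]
  refine Prod.ext rfl ?_
  change ((1 / 2 : ℝ) : ℂ) * (starRingEnd ℂ) (‖y‖⁻¹ • (dir y : ℂ)) = z
  rw [coe_dir hy0, smul_smul, Complex.real_smul, map_mul, Complex.conj_ofReal]
  -- This turns the conjugated, rescaled direction into the inverse `1 / (2 y)`, which is `z` by the
  -- choice of `y`.
  have h1 : (starRingEnd ℂ) y = (‖y‖ : ℂ) ^ 2 * y⁻¹ := by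
    rw [← Complex.conj_mul', mul_assoc, mul_inv_cancel₀ hy0, mul_one]
  have h2 : (‖y‖ : ℂ) ≠ 0 := by exact_mod_cast hyn.ne'
  rw [h1, hy, inv_inv, ← hy]
  push_cast
  field_simp

/-- For the matrix of `(λ, -μ)` the twist is `(s, |y| τ) ↦ (s, |y| τ⁻¹)`, and inversion on the unit
circle is complex conjugation. The sign in `-μ` is thus the conjugation on normal discs in the
definition of `satellite`. -/
theorem conj_std_eq_ofBasis {q : Circle × Circle × ℂ} (hq : q.2.2 ∈ annulus) :
    ((OpenPartialHomeomorph.refl Circle).prod ((OpenPartialHomeomorph.refl Circle).prod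
      (conjScale 1 one_ne_zero))) (Collar.std.map q) =
      (Collar.ofBasis basisLambdaNegMu).map q := by
  obtain ⟨u, s, z⟩ := q
  have hz : z ≠ 0 := ne_zero_of_mem_annulus hq
  set y : ℂ := (2 * z)⁻¹ with hy
  change (u, s, ((1 : ℝ) : ℂ) * (starRingEnd ℂ) y) = (u, twistFun 0 1 (-1) 0 (s, y))
  have h := congrArg (starRingEnd ℂ) (norm_smul_dir y)
  rw [Complex.real_smul, map_mul, Complex.conj_ofReal] at h
  simp [twistFun, ← h, ← Circle.coe_inv_eq_conj]

/-! ### The tubular neighbourhood of a fiber as an exterior of the axis -/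

namespace TorusNhd

variable {M : Mfd4} (ν : TorusNhd M)

/-- The identification of `S¹ × (S³ ∖ ν(A))` with a tubular neighbourhood of a framed torus. -/
noncomputable def ofExterior : OpenPartialHomeomorph circleTimesS3 M := torusExterior.trans ν.map

theorem isDiffeo_ofExterior : IsDiffeo I4 I4 ν.ofExterior :=
  isDiffeo_torusExterior.trans ν.isDiffeo

theorem mem_source_iff {q : Circle × Circle × ℂ} : q ∈ ν.map.source ↔ ‖q.2.2‖ < 1 := by
  rw [ν.source_eq]
  simp

/-- The solid torus coordinate has norm `‖x 0‖ / (2 ‖x 1‖)`. It is less than `1` precisely where `2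
‖x 1‖ ≤ ‖x 0‖` fails, so the open neighbourhood `ν` corresponds to exactly the part of `S¹ × S³`
left after removing the closed tube of the axis. -/
theorem ofExterior_source : ν.ofExterior.source = axis.torus.tubeᶜ := by
  ext p
  have h1 : p ∈ ν.ofExterior.source ↔ p.2.1 1 ≠ 0 ∧ ‖(axisComplement p.2).2‖ < 1 := by
    rw [ofExterior, OpenPartialHomeomorph.trans_source, mem_inter_iff, mem_preimage,
      mem_source_iff]
    exact and_congr_left' ⟨fun h => h.2.1, fun h => ⟨trivial, h, trivial, trivial⟩⟩
  rw [h1, norm_axisComplement, mem_compl_iff]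
  rw [show (p ∈ axis.torus.tube ↔ _) from mem_axis_torus_tube p, not_le]
  constructor
  · rintro ⟨h2, h3⟩
    have h4 := norm_pos_iff.2 h2
    rw [div_lt_iff₀ two_pos, inv_mul_lt_iff₀ h4] at h3
    linarith
  · intro h
    -- The strict inequality already excludes `x 1 = 0`, where the solid torus coordinates break
    -- down.
    have h4 : 0 < ‖p.2.1 1‖ := by linarith [norm_nonneg (p.2.1 0)]
    refine ⟨norm_pos_iff.1 h4, ?_⟩
    rw [div_lt_iff₀ two_pos, inv_mul_lt_iff₀ h4]
    linarith

theorem exists_ofExterior_eq {q : Circle × Circle × ℂ} (hq : ‖q.2.2‖ < 1) :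
    ∃ p ∈ ν.ofExterior.source, ν.ofExterior p = ν.map q := by
  have h := torusExterior.right_inv (mem_torusExterior_target q)
  refine ⟨torusExterior.symm q, ⟨torusExterior.map_target (mem_torusExterior_target q), ?_⟩, ?_⟩
  · change torusExterior (torusExterior.symm q) ∈ ν.map.source
    rw [h]
    exact ν.mem_source_iff.2 hq
  · exact congrArg ν.map h

/-- The image of `ofExterior` has normal radius below `1`, and the closed tube takes up the radii up
to `1/2`; only the collar remains. -/
theorem exists_of_ofExterior_not_mem_tube {p : circleTimesS3} (hp : p ∈ ν.ofExterior.source)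
    (h : ν.ofExterior p ∉ ν.tube) : ∃ q, q.2.2 ∈ annulus ∧ ν.map q = ν.ofExterior p := by
  refine ⟨torusExterior p, ⟨?_, ν.mem_source_iff.1 hp.2⟩, rfl⟩
  by_contra h1
  exact h ⟨_, ⟨trivial, trivial, by simpa using h1⟩, rfl⟩

/-- On the collar, `ofExterior` undoes the gluing along the axis. This is the precise form of the
fact that gluing the exterior of the axis to the complement of `ν` with basis `(μ, λ)` restores the
manifold. -/
theorem ofExterior_collarMap {q : Circle × Circle × ℂ} (hq : q.2.2 ∈ annulus) :
    ν.ofExterior (collarMap axis.torus ν (Collar.ofBasis basisMuLambda) (ν.map q)) =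
      ν.map q := by
  rw [collarMap_apply _ _ _ hq]
  exact congrArg ν.map (torusExterior_axis_ofBasis hq)

variable (K : KnotTube)

/-- Complex conjugation in the normal direction. -/
noncomputable abbrev conjNormal : OpenPartialHomeomorph (Circle × Circle × ℂ) (Circle × Circle × ℂ) :=
  (OpenPartialHomeomorph.refl Circle).prod ((OpenPartialHomeomorph.refl Circle).prod
    (conjScale 1 one_ne_zero))

theorem norm_conjNormal (q : Circle × Circle × ℂ) : ‖(conjNormal q).2.2‖ = ‖q.2.2‖ := by
  simp [conjNormal, conjScale]

theorem conjNormal_conjNormal (q : Circle × Circle × ℂ) : conjNormal (conjNormal q) = q := by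
  simp [conjNormal, conjScale]

/-- A regrouping of the compositions: the satellite torus is the image of `S¹ × K` under
`ofExterior`, up to conjugation in the normal discs. -/
theorem satellite_map (hK : Disjoint axis.map.target K.map.target) (q : Circle × Circle × ℂ) :
    (ν.satellite K hK).map q = ν.ofExterior (K.torus.map (conjNormal q)) := rfl

/-- The tube of `K` avoids the open neighbourhood of the axis and hence the smaller closed tube,
whose complement is the source. -/
theorem torus_mem_ofExterior_source (hK : Disjoint axis.map.target K.map.target)
    {q : Circle × Circle × ℂ} (hq : ‖q.2.2‖ < 1) :
    K.torus.map q ∈ ν.ofExterior.source := by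
  rw [ofExterior_source]
  rintro ⟨p, hp, h⟩
  refine Set.disjoint_left.1 (KnotTube.torus_disjoint hK) (axis.torus.map.map_source
    (axis.torus.mem_source_iff.2 (?_ : ‖p.2.2‖ < 1))) (h ▸ K.torus.map.map_source
    (K.torus.mem_source_iff.2 hq))
  have := mem_closedBall_zero_iff.1 hp.2.2
  linarith

/-- The whole open neighbourhood of the satellite torus has radius at most `1/2` in `ν`. Indeed, the
collar of `ν` corresponds to the collar of the axis, which lies in the open neighbourhood of the
axis, and `K` avoids all of that neighbourhood. -/
theorem satellite_map_mem_tube (hK : Disjoint axis.map.target K.map.target)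
    {q : Circle × Circle × ℂ} (hq : ‖q.2.2‖ < 1) :
    (ν.satellite K hK).map q ∈ ν.tube := by
  rw [satellite_map]
  have hq' : ‖(conjNormal q).2.2‖ < 1 := by rwa [norm_conjNormal]
  set p := K.torus.map (conjNormal q) with hp
  have hpK : p ∈ K.torus.map.target := K.torus.map.map_source (K.torus.mem_source_iff.2 hq')
  have h1 : p ∉ axis.torus.map.target := fun h =>
    Set.disjoint_left.1 (KnotTube.torus_disjoint hK) h hpK
  have h2 : p ∈ ν.ofExterior.source := ν.torus_mem_ofExterior_source K hK hq'
  by_contra h3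
  obtain ⟨q', hq', h4⟩ := ν.exists_of_ofExterior_not_mem_tube h2 h3
  refine h1 ?_
  -- The collar point is carried over to the collar of the axis. Since `ofExterior` maps it back and
  -- is injective, it must be the original point `p` of `S¹ × K`'s neighbourhood, which then lies
  -- near the axis.
  have h5 : collarMap axis.torus ν (Collar.ofBasis basisMuLambda) (ν.map q') ∈
      (collarMap axis.torus ν (Collar.ofBasis basisMuLambda)).target :=
    OpenPartialHomeomorph.map_source _ ((mem_collarMap_source _ _ _).2 ⟨q', hq', rfl⟩)
  have h6 := (mem_collarMap_target _ _ _).1 h5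
  obtain ⟨q'', hq'', h7⟩ := h6
  have h8 : axis.torus.map q'' ∈ ν.ofExterior.source := by
    rw [ofExterior_source]
    exact TorusNhd.not_mem_tube _ hq''
  have h9 := ν.ofExterior_collarMap hq'
  rw [← h7, h4] at h9
  rw [← ν.ofExterior.injOn h8 h2 h9]
  exact axis.torus.map.map_source (axis.torus.mem_source_iff.2 hq''.2)

/-- Conjugation in the normal discs preserves the radius and `ofExterior` is injective on its
source, so closed tubes correspond. -/
theorem ofExterior_mem_satellite_tube (hK : Disjoint axis.map.target K.map.target)
    {p : circleTimesS3} (hp : p ∈ ν.ofExterior.source) :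
    ν.ofExterior p ∈ (ν.satellite K hK).tube ↔ p ∈ K.torus.tube := by
  constructor
  · rintro ⟨q, hq, h⟩
    have hq1 := mem_closedBall_zero_iff.1 hq.2.2
    have hq2 : ‖(conjNormal q).2.2‖ ≤ 1 / 2 := by rwa [norm_conjNormal]
    rw [satellite_map] at h
    refine ⟨conjNormal q, ⟨trivial, trivial, mem_closedBall_zero_iff.2 hq2⟩,
      ν.ofExterior.injOn (ν.torus_mem_ofExterior_source K hK ?_) hp h⟩
    linarith
  · rintro ⟨q, hq, rfl⟩
    refine ⟨conjNormal q, ⟨trivial, trivial, ?_⟩, ?_⟩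
    · rw [mem_closedBall_zero_iff, norm_conjNormal]
      exact mem_closedBall_zero_iff.1 hq.2.2
    · rw [satellite_map, conjNormal_conjNormal]

end TorusNhd

/-! ### The fiber sum along a satellite torus -/

section Satellite

variable (X Y : FramedMfd) (K : KnotTube) (hK : Disjoint axis.map.target K.map.target)

/-- The gluing data of the fiber sum along the torus defined by a knot in the exterior of the
axis. -/
noncomputable def satelliteGluing : Gluing Unit := fiberGluing ⟨X.mfd, X.nhd.satellite K hK⟩ Y

/-- The gluing data of the link surgery along the axis and a knot in its exterior. -/
noncomputable def surgeryGluing : Gluing (Fin 2) :=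
  glueAlong circleTimesS3 (fun i => (![X, Y] i).mfd) (fun i => (braidLink K i).torus)
    (fun i k h => KnotTube.torus_disjoint (braidLink_disjoint hK i k h))
    (fun i => (![X, Y] i).nhd)
    (fun i => Collar.ofBasis (![basisMuLambda, basisLambdaNegMu] i))

instance (j : Option Unit) : Nonempty ((satelliteGluing X Y K hK).dom j) :=
  Gluing.nonempty_dom _ (fun _ => nonempty_collarMap_source _ _ _) j

instance (j : Option (Fin 2)) : Nonempty ((surgeryGluing X Y K hK).dom j) :=
  Gluing.nonempty_dom _ (fun _ => nonempty_collarMap_source _ _ _) j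

/-- The pieces of the link surgery, as open subsets of the fiber sum. -/
noncomputable def satelliteChart : ∀ j : Option (Fin 2),
    OpenPartialHomeomorph ((surgeryGluing X Y K hK).piece j) (satelliteGluing X Y K hK).result
  | none => X.nhd.ofExterior.trans ((satelliteGluing X Y K hK).incl none)
  | some 0 => ((satelliteGluing X Y K hK).incl none).restrOpen X.nhd.tubeᶜ
      (X.nhd.isClosed_image (r := 1 / 2) (by norm_num)).isOpen_compl
  | some 1 => (satelliteGluing X Y K hK).incl (some ())

theorem isDiffeo_satelliteChart :
    ∀ j, IsDiffeo I4 I4 (satelliteChart X Y K hK j)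
  | none => X.nhd.isDiffeo_ofExterior.trans ((satelliteGluing X Y K hK).isDiffeo_incl none)
  | some 0 => ((satelliteGluing X Y K hK).isDiffeo_incl none).restr
      (X.nhd.isClosed_image (r := 1 / 2) (by norm_num)).isOpen_compl
  | some 1 => (satelliteGluing X Y K hK).isDiffeo_incl (some ())

theorem surgeryGluing_dom_none :
    (surgeryGluing X Y K hK).dom none = (axis.torus.tube ∪ K.torus.tube)ᶜ := by
  change (⋃ i, (braidLink K i).torus.tube)ᶜ = _
  congr 1
  ext p
  rw [mem_iUnion, Fin.exists_fin_two]
  rfl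

theorem satelliteGluing_dom_none :
    (satelliteGluing X Y K hK).dom none = (X.nhd.satellite K hK).tubeᶜ := by
  change (⋃ _ : Unit, (X.nhd.satellite K hK).tube)ᶜ = _
  rw [iUnion_const]

/-- The tube removed for the fiber sum lies inside the tube of the fiber, so the complement of the
latter survives intact. -/
theorem tube_compl_subset_dom : X.nhd.tubeᶜ ⊆ (satelliteGluing X Y K hK).dom none := by
  rw [satelliteGluing_dom_none, compl_subset_compl]
  rintro _ ⟨q, hq, rfl⟩
  refine X.nhd.satellite_map_mem_tube K hK ?_
  have := mem_closedBall_zero_iff.1 hq.2.2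
  linarith

/-- For the exterior piece, the source of `ofExterior` accounts for removing the tube of the axis,
and the domain of `X` in the fiber sum accounts for removing the tube of `K`. For the other two
pieces the same tubes are removed on both sides. -/
theorem satelliteChart_source :
    ∀ j, (satelliteChart X Y K hK j).source = (surgeryGluing X Y K hK).dom j
  | none => by
    rw [surgeryGluing_dom_none]
    ext p
    change p ∈ X.nhd.ofExterior.source ∧
      X.nhd.ofExterior p ∈ ((satelliteGluing X Y K hK).incl none).source ↔ _
    rw [Gluing.incl_source, satelliteGluing_dom_none, compl_union, ← X.nhd.ofExterior_source]
    exact and_congr_right fun hp => not_congr (X.nhd.ofExterior_mem_satellite_tube K hK hp)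
  | some 0 => by
    change ((satelliteGluing X Y K hK).incl none).source ∩ X.nhd.tubeᶜ = X.nhd.tubeᶜ
    rw [Gluing.incl_source]
    exact inter_eq_right.2 (tube_compl_subset_dom X Y K hK)
  | some 1 => (satelliteGluing X Y K hK).incl_source (some ())

theorem exists_satelliteChart_eq (z : (satelliteGluing X Y K hK).result) :
    ∃ j, ∃ x ∈ (satelliteChart X Y K hK j).source, satelliteChart X Y K hK j x = z := by
  obtain ⟨_ | _, x, hx, rfl⟩ := (satelliteGluing X Y K hK).exists_incl_eq z
  -- The part of `X` inside the closed tube of the fiber is reached from the link exterior, the rest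
  -- from `X ∖ ν(F)`.
  · by_cases h : x ∈ X.nhd.tube
    · obtain ⟨q, hq, rfl⟩ := h
      have hq1 := mem_closedBall_zero_iff.1 hq.2.2
      obtain ⟨p, hp, h⟩ := X.nhd.exists_ofExterior_eq (q := q) (by linarith)
      refine ⟨none, p, ⟨hp, ?_⟩, congrArg ((satelliteGluing X Y K hK).incl none) h⟩
      change X.nhd.ofExterior p ∈ ((satelliteGluing X Y K hK).incl none).source
      rw [h, Gluing.incl_source]
      exact hx
    · refine ⟨some 0, x, ?_, rfl⟩
      rw [satelliteChart_source]
      exact h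
  · refine ⟨some 1, x, ?_, rfl⟩
    rw [satelliteChart_source]
    exact hx

/-- In the fiber sum both points come from the single piece `X`, so they coincide only when `x =
ofExterior p`. In the surgery they coincide when the collar gluing takes `x` to `p`. These
conditions agree because `ofExterior` inverts that gluing on the collar. -/
theorem satelliteChart_zero_eq_none {x : X.mfd} {p : circleTimesS3}
    (hx : x ∈ (surgeryGluing X Y K hK).dom (some 0))
    (hp : p ∈ (surgeryGluing X Y K hK).dom none) :
    satelliteChart X Y K hK (some 0) x = satelliteChart X Y K hK none p ↔
      (surgeryGluing X Y K hK).incl (some 0) x = (surgeryGluing X Y K hK).incl none p := by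
  have hpS : p ∈ (satelliteChart X Y K hK none).source := by rwa [satelliteChart_source]
  have hp1 : p ∈ X.nhd.ofExterior.source := hpS.1
  have hp2 : X.nhd.ofExterior p ∈ (satelliteGluing X Y K hK).dom none := by
    rw [← Gluing.incl_source]
    exact hpS.2
  rw [Gluing.incl_some_eq_incl_none _ hx hp]
  change (satelliteGluing X Y K hK).incl none x =
    (satelliteGluing X Y K hK).incl none (X.nhd.ofExterior p) ↔
    x ∈ (collarMap axis.torus X.nhd (Collar.ofBasis basisMuLambda)).source ∧
      collarMap axis.torus X.nhd (Collar.ofBasis basisMuLambda) x = p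
  rw [Gluing.incl_self_eq _ (tube_compl_subset_dom X Y K hK hx) hp2]
  constructor
  · intro h
    -- Being outside the closed tube and in the image of the exterior, `x` is a collar point. Then
    -- `p` and the image of `x` under the gluing have the same image under `ofExterior`, which is
    -- injective.
    obtain ⟨q, hq, hqx⟩ := X.nhd.exists_of_ofExterior_not_mem_tube hp1 (h ▸ hx)
    rw [← h] at hqx
    have hs : x ∈ (collarMap axis.torus X.nhd (Collar.ofBasis basisMuLambda)).source :=
      (mem_collarMap_source _ _ _).2 ⟨q, hq, hqx⟩
    refine ⟨hs, X.nhd.ofExterior.injOn ?_ hp1 ?_⟩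
    · rw [TorusNhd.ofExterior_source]
      obtain ⟨q', hq', h'⟩ := (mem_collarMap_target _ _ _).1 (OpenPartialHomeomorph.map_source _ hs)
      rw [← h']
      exact TorusNhd.not_mem_tube _ hq'
    · rw [← h, ← hqx, X.nhd.ofExterior_collarMap hq]
  · rintro ⟨hs, rfl⟩
    obtain ⟨q, hq, rfl⟩ := (mem_collarMap_source _ _ _).1 hs
    rw [X.nhd.ofExterior_collarMap hq]

/-- The fiber sum gluing along the satellite torus is `ofExterior` composed with the surgery gluing
along `K`, by `conj_std_eq_ofBasis`; injectivity of `ofExterior` cancels it. -/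
theorem satelliteChart_one_eq_none {y : Y.mfd} {p : circleTimesS3}
    (hy : y ∈ (surgeryGluing X Y K hK).dom (some 1))
    (hp : p ∈ (surgeryGluing X Y K hK).dom none) :
    satelliteChart X Y K hK (some 1) y = satelliteChart X Y K hK none p ↔
      (surgeryGluing X Y K hK).incl (some 1) y = (surgeryGluing X Y K hK).incl none p := by
  have hpS : p ∈ (satelliteChart X Y K hK none).source := by rwa [satelliteChart_source]
  have hp1 : p ∈ X.nhd.ofExterior.source := hpS.1
  have hp2 : X.nhd.ofExterior p ∈ (satelliteGluing X Y K hK).dom none := by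
    rw [← Gluing.incl_source]
    exact hpS.2
  rw [Gluing.incl_some_eq_incl_none _ hy hp]
  change (satelliteGluing X Y K hK).incl (some ()) y =
    (satelliteGluing X Y K hK).incl none (X.nhd.ofExterior p) ↔
    y ∈ (collarMap K.torus Y.nhd (Collar.ofBasis basisLambdaNegMu)).source ∧
      collarMap K.torus Y.nhd (Collar.ofBasis basisLambdaNegMu) y = p
  rw [Gluing.incl_some_eq_incl_none (satelliteGluing X Y K hK) (i := ()) hy hp2]
  change y ∈ (collarMap (X.nhd.satellite K hK) Y.nhd Collar.std).source ∧
    collarMap (X.nhd.satellite K hK) Y.nhd Collar.std y = X.nhd.ofExterior p ↔ _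
  -- Both gluings are defined on the same collar in `Y`, whatever the target torus and the collar
  -- map, so only the values are left to compare.
  rw [mem_collarMap_source, mem_collarMap_source]
  refine and_congr_right ?_
  rintro ⟨q, hq, rfl⟩
  rw [collarMap_apply _ _ _ hq, collarMap_apply _ _ _ hq, TorusNhd.satellite_map,
    TorusNhd.conjNormal, conj_std_eq_ofBasis hq]
  refine X.nhd.ofExterior.injOn.eq_iff (X.nhd.torus_mem_ofExterior_source K hK ?_) hp1
  -- Collar maps preserve the annulus, which gives the radius bound needed for the point of `S¹ ×
  -- K`'s neighbourhood to lie in the source of `ofExterior`.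
  have h : q ∈ (Collar.ofBasis basisLambdaNegMu).map.source := by
    rw [(Collar.ofBasis basisLambdaNegMu).source_eq]
    exact ⟨trivial, trivial, hq⟩
  have h2 := (Collar.ofBasis basisLambdaNegMu).map.map_source h
  rw [(Collar.ofBasis basisLambdaNegMu).target_eq] at h2
  exact h2.2.2.2

/-- A point of `Y` that is glued into `X` lands in the neighbourhood of the satellite torus, hence
in the closed tube of the fiber, which has been removed from the piece containing `x`. -/
theorem satelliteChart_one_ne_zero {x : X.mfd} {y : Y.mfd}
    (hx : x ∈ (surgeryGluing X Y K hK).dom (some 0))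
    (hy : y ∈ (surgeryGluing X Y K hK).dom (some 1)) :
    satelliteChart X Y K hK (some 1) y ≠ satelliteChart X Y K hK (some 0) x := by
  change (satelliteGluing X Y K hK).incl (some ()) y ≠ (satelliteGluing X Y K hK).incl none x
  rw [Ne, Gluing.incl_some_eq_incl_none (satelliteGluing X Y K hK) (i := ()) hy
    (tube_compl_subset_dom X Y K hK hx)]
  rintro ⟨h1, h2⟩
  have h3 := (satelliteGluing X Y K hK).glue () |>.map_source h1
  rw [h2] at h3
  obtain ⟨q, hq, rfl⟩ := (mem_collarMap_target (X.nhd.satellite K hK) Y.nhd Collar.std).1 h3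
  exact hx (X.nhd.satellite_map_mem_tube K hK hq.2)

/-- The fiber sum of `X` and `Y`, along the torus in `X` defined by a knot in the exterior of the
axis, is the link surgery along the axis and the knot. -/
theorem nonempty_diffeomorph_satellite_surgery :
    Nonempty (Diffeomorph I4 I4 (satelliteGluing X Y K hK).result
      (surgeryGluing X Y K hK).result ∞) := by
  refine nonempty_diffeomorph_of_charts (satelliteChart X Y K hK)
    (fun j => (surgeryGluing X Y K hK).incl j) (isDiffeo_satelliteChart X Y K hK)
    (fun j => (surgeryGluing X Y K hK).isDiffeo_incl j)
    (fun j => (satelliteChart_source X Y K hK j).trans (Gluing.incl_source _ j).symm)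
    (exists_satelliteChart_eq X Y K hK) (fun z => ?_) fun j k x hx y hy => ?_
  · obtain ⟨j, x, hx, h⟩ := (surgeryGluing X Y K hK).exists_incl_eq z
    exact ⟨j, x, by rwa [Gluing.incl_source], h⟩
  -- Within one piece both inclusions are injective, so each equality reduces to `x = y`.
  have self : ∀ j, ∀ x ∈ (surgeryGluing X Y K hK).dom j, ∀ y ∈ (surgeryGluing X Y K hK).dom j,
      (satelliteChart X Y K hK j x = satelliteChart X Y K hK j y ↔
        (surgeryGluing X Y K hK).incl j x = (surgeryGluing X Y K hK).incl j y) := by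
    intro j x hx y hy
    rw [Gluing.incl_self_eq _ hx hy]
    exact (satelliteChart X Y K hK j).injOn.eq_iff (by rwa [satelliteChart_source])
      (by rwa [satelliteChart_source])
  rw [Gluing.incl_source] at hx hy
  match j, k with
  | none, none => exact self _ _ hx _ hy
  | none, some 0 =>
    rw [eq_comm, satelliteChart_zero_eq_none X Y K hK hy hx, eq_comm]
  | none, some 1 =>
    rw [eq_comm, satelliteChart_one_eq_none X Y K hK hy hx, eq_comm]
  | some 0, none => exact satelliteChart_zero_eq_none X Y K hK hx hy
  | some 1, none => exact satelliteChart_one_eq_none X Y K hK hx hy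
  | some 0, some 0 => exact self _ _ hx _ hy
  | some 1, some 1 => exact self _ _ hx _ hy
  | some 0, some 1 =>
    exact iff_of_false (satelliteChart_one_ne_zero X Y K hK hx hy).symm
      (Gluing.incl_some_ne_incl_some _ (by decide) hx hy)
  | some 1, some 0 =>
    exact iff_of_false (satelliteChart_one_ne_zero X Y K hK hy hx)
      (Gluing.incl_some_ne_incl_some _ (by decide) hx hy)

end Satellite

end LinkSurgery

/-- The general comparison with `X = E(n)`, `Y = E(r)` and the tube of the closed braid. The fiber
sum and the link surgery unfold to the two gluings compared there. -/
theorem lemma2p3 (D D' : LinkSurgery.EllipticData) (n r p q : ℕ)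
    (hn : 1 ≤ n) (hr : 1 ≤ r) (hp : 1 ≤ p) (hq : 2 ≤ q)
    (B : LinkSurgery.KnotTube) (hB : LinkSurgery.IsBraidTube p q B) :
    Nonempty (Diffeomorph LinkSurgery.I4 LinkSurgery.I4
      (LinkSurgery.fiberSum
        ⟨(LinkSurgery.elliptic D n).mfd,
          (LinkSurgery.elliptic D n).nhd.satellite B hB.disjoint_axis⟩
        (LinkSurgery.elliptic D' r))
      (LinkSurgery.linkSurgery ![LinkSurgery.elliptic D n, LinkSurgery.elliptic D' r]
        (LinkSurgery.braidLink B) (LinkSurgery.braidLink_disjoint hB.disjoint_axis)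
        ![LinkSurgery.basisMuLambda, LinkSurgery.basisLambdaNegMu])
      ∞) :=
  LinkSurgery.nonempty_diffeomorph_satellite_surgery (LinkSurgery.elliptic D n)
    (LinkSurgery.elliptic D' r) B hB.disjoint_axis
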